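/- All graphs are finite and simple. A (vertex-)colored graph is a graph $X$ together with an arbitrary map $c : V(X) \to C$ to a set of colors (adjacent vertices may have the same color). A magic unitary over a unital $C^*$-algebra is a matrix of projections each of whose rows and columns sums to $1$. The quantum automorphism group $\mathrm{Qut}_c(X)$ is the compact matrix quantum group $(C(\mathrm{Qut}_c(X)), u)$, where $C(\mathrm{Qut}_c(X))$ is the universal unital $C^*$-algebra with generators $u_{ij}$ $(i,j \in V(X))$ subject to the relations that $u = (u_{ij})$ is a magic unitary, $u_{ij}u_{kl} = 0$ whenever exactly one of $ik$, $jl$ is an edge of $X$, and $u_{ij} = 0$ whenever $c(i) \neq c(j)$; its comultiplication is $\Delta(u_{ij}) = \sum_k u_{ik} \otimes u_{kj}$. Colored graphs $X$ and $Y$ are quantum isomorphic if there are a nonzero unital $C^*$-algebra $\mathcal A$ and a magic unitary $u = (u_{xy})_{x \in V(X), y \in V(Y)}$ over $\mathcal A$ such that $A_X u = u A_Y$ (with $A_X, A_Y$ the adjacency matrices) and $u_{xy} = 0$ whenever $c(x) \neq c(y)$. The free product $\ast_i \mathbb G_i$ of compact matrix quantum groups $\mathbb G_i = (C(\mathbb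 G_i), u^{(i)})$ is given by the unital free product (with identified units) of the $C^*$-algebras $C(\mathbb G_i)$ with fundamental representation the block-diagonal matrix $\bigoplus_i u^{(i)}$. Lemma. Let $X_1, \dots, X_n$ be vertex-colored graphs (with colors in a common set) such that for all $i \neq j$ no connected component of $X_i$ is quantum isomorphic to a connected component of $X_j$. Then $$\mathrm{Qut}_c\Big(\bigsqcup_{i=1}^n X_i\Big) = \mathop{\ast}_{i=1}^n \mathrm{Qut}_c(X_i)$$ as compact matrix quantum groups: there is a $*$-isomorphism between the two $C^*$-algebras that maps the fundamental representation of $\mathrm{Qut}_c(\bigsqcup_i X_i)$ entrywise to $\bigoplus_i u^{(i)}$, where $u^{(i)}$ is the fundamental representation of $\mathrm{Qut}_c(X_i)$, and that intertwines the comultiplications. -/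

import Mathlib

open scoped TensorProduct

universe u

/-! ### Completions of complex star-algebras with respect to C*-seminorms -/

/-- A C*-seminorm on a unital complex *-algebra: a submultiplicative seminorm satisfying the
C*-identity `p (a* a) = p a ^ 2`. -/
structure CStarSeminorm (A : Type*) [Ring A] [StarRing A] [Algebra ℂ A] extends
    Seminorm ℂ A where
  mul_le' : ∀ a b, toFun (a * b) ≤ toFun a * toFun b
  star_mul_self' : ∀ a, toFun (star a * a) = toFun a ^ 2

namespace CStarSeminorm

section Basic

variable {A : Type*} [Ring A] [StarRing A] [Algebra ℂ A]

noncomputable instance : CoeFun (CStarSeminorm A) (fun _ => A → ℝ) := ⟨fun p => p.toSeminorm⟩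

theorem mul_le (p : CStarSeminorm A) (a b : A) : p (a * b) ≤ p a * p b := p.mul_le' a b

theorem star_mul_self (p : CStarSeminorm A) (a : A) : p (star a * a) = p a ^ 2 :=
  p.star_mul_self' a

theorem nonneg (p : CStarSeminorm A) (a : A) : 0 ≤ p a := apply_nonneg p.toSeminorm a

theorem le_star (p : CStarSeminorm A) (a : A) : p a ≤ p (star a) := by
  rcases (p.nonneg a).eq_or_lt with h | h
  · rw [← h]; exact p.nonneg _
  · have h1 := p.star_mul_self a
    have h2 := p.mul_le (star a) a
    rw [h1, sq] at h2
    exact le_of_mul_le_mul_right h2 h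

theorem star_eq (p : CStarSeminorm A) (a : A) : p (star a) = p a :=
  le_antisymm (by simpa using p.le_star (star a)) (p.le_star a)

/-- A copy of `A`, carrying the seminorm `p`. -/
def Alg (_ : CStarSeminorm A) : Type _ := A

variable (p : CStarSeminorm A)

instance : Ring p.Alg := inferInstanceAs (Ring A)
instance : StarRing p.Alg := inferInstanceAs (StarRing A)
instance : Algebra ℂ p.Alg := inferInstanceAs (Algebra ℂ A)
instance [StarModule ℂ A] : StarModule ℂ p.Alg := inferInstanceAs (StarModule ℂ A)

/-- The identity map `A → p.Alg`. -/
noncomputable def toAlg : A →⋆ₐ[ℂ] p.Alg := StarAlgHom.id ℂ A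

noncomputable instance : SeminormedRing p.Alg :=
  { (inferInstance : Ring p.Alg), p.toAddGroupSeminorm.toSeminormedAddCommGroup with
    norm_mul_le := p.mul_le' }

theorem norm_toAlg (a : A) : ‖p.toAlg a‖ = p a := rfl

noncomputable instance : NormedAlgebra ℂ p.Alg where
  norm_smul_le c a := (map_smul_eq_mul p.toSeminorm c a).le

theorem norm_star_alg (a : p.Alg) : ‖star a‖ = ‖a‖ := p.star_eq a

theorem norm_star_mul_self_alg (a : p.Alg) : ‖star a * a‖ = ‖a‖ ^ 2 := p.star_mul_self a

/-- The C*-algebra obtained from `A` by dividing out the null space of `p` and completing. -/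
def Completion : Type _ := UniformSpace.Completion p.Alg

noncomputable instance : NormedRing p.Completion :=
  inferInstanceAs (NormedRing (UniformSpace.Completion p.Alg))

noncomputable instance : Algebra ℂ p.Completion :=
  inferInstanceAs (Algebra ℂ (UniformSpace.Completion p.Alg))

instance : CompleteSpace p.Completion :=
  inferInstanceAs (CompleteSpace (UniformSpace.Completion p.Alg))

noncomputable instance : NormedAlgebra ℂ p.Completion where
  norm_smul_le c a := norm_smul_le (β := UniformSpace.Completion p.Alg) c a

/-- The canonical ring homomorphism with dense range into the completion. -/
noncomputable def coeRingHom : A →+* p.Completion :=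
  (UniformSpace.Completion.coeRingHom : p.Alg →+* UniformSpace.Completion p.Alg)

theorem norm_coe (a : A) : ‖p.coeRingHom a‖ = p a :=
  UniformSpace.Completion.norm_coe (p.toAlg a)

theorem denseRange_coe : DenseRange p.coeRingHom :=
  UniformSpace.Completion.denseRange_coe (α := p.Alg)

theorem uniformContinuous_star_alg : UniformContinuous (star : p.Alg → p.Alg) := by
  have : Isometry (starAddEquiv : p.Alg ≃+ p.Alg) :=
    AddMonoidHomClass.isometry_of_norm _ (fun a => p.norm_star_alg a)
  exact this.uniformContinuous

noncomputable instance : Star p.Completion :=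
  ⟨UniformSpace.Completion.map (star : p.Alg → p.Alg)⟩

theorem coe_star (a : A) : p.coeRingHom (star a) = star (p.coeRingHom a) :=
  (UniformSpace.Completion.map_coe p.uniformContinuous_star_alg (p.toAlg a)).symm

theorem continuous_star_completion : Continuous (star : p.Completion → p.Completion) :=
  UniformSpace.Completion.continuous_map

variable {p} in
theorem completion_induction {P : p.Completion → Prop} (a : p.Completion)
    (hP : IsClosed {a | P a}) (h : ∀ a : A, P (p.coeRingHom a)) : P a :=
  p.denseRange_coe.induction_on a hP h

noncomputable instance : StarRing p.Completion where
  star_involutive a := by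
    induction a using completion_induction with
    | hP => exact isClosed_eq
              (p.continuous_star_completion.comp p.continuous_star_completion) continuous_id
    | h a => rw [← coe_star, ← coe_star, star_star]
  star_mul a b := by
    have hs := p.continuous_star_completion
    induction a using completion_induction with
    | hP => exact isClosed_eq (hs.comp (by fun_prop)) (by fun_prop)
    | h a =>
      induction b using completion_induction with
      | hP => exact isClosed_eq (hs.comp (by fun_prop)) (by fun_prop)
      | h b => rw [← map_mul, ← coe_star, ← coe_star, ← coe_star, star_mul, map_mul]
  star_add a b := by
    have hs := p.continuous_star_completion
    induction a using completion_induction with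
    | hP => exact isClosed_eq (hs.comp (by fun_prop)) (by fun_prop)
    | h a =>
      induction b using completion_induction with
      | hP => exact isClosed_eq (hs.comp (by fun_prop)) (by fun_prop)
      | h b => rw [← map_add, ← coe_star, ← coe_star, ← coe_star, star_add, map_add]

theorem coe_algebraMap (c : ℂ) : p.coeRingHom (algebraMap ℂ A c) = algebraMap ℂ p.Completion c :=
  rfl

theorem coe_smul (c : ℂ) (a : A) : p.coeRingHom (c • a) = c • p.coeRingHom a := by
  rw [Algebra.smul_def, map_mul, coe_algebraMap, ← Algebra.smul_def]

/-- The canonical *-homomorphism with dense range into the completion. -/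
noncomputable def coe : A →⋆ₐ[ℂ] p.Completion where
  __ := p.coeRingHom
  commutes' := p.coe_algebraMap
  map_star' := p.coe_star

theorem coe_denseRange : DenseRange p.coe := p.denseRange_coe

theorem norm_coe_apply (a : A) : ‖p.coe a‖ = p a := p.norm_coe a

theorem induction_on {P : p.Completion → Prop} (a : p.Completion)
    (hP : IsClosed {a | P a}) (h : ∀ a : A, P (p.coe a)) : P a :=
  p.coe_denseRange.induction_on a hP h

/-- A *-homomorphism into a C*-algebra whose norm is dominated by `p` extends to the completion. -/
noncomputable def lift {B : Type*} [CStarAlgebra B] (f : A →⋆ₐ[ℂ] B) (hf : ∀ a, ‖f a‖ ≤ p a) :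
    p.Completion →⋆ₐ[ℂ] B :=
  let g : p.Alg →+* B := (f : A →+* B)
  have hg : Continuous g :=
    (AddMonoidHomClass.lipschitz_of_bound g 1 (fun a => by simpa using! hf a)).continuous
  have key : ∀ a : A, UniformSpace.Completion.extensionHom g hg (p.coeRingHom a) = f a :=
    fun a => UniformSpace.Completion.extensionHom_coe g hg (p.toAlg a)
  have hc : Continuous (fun a : p.Completion => UniformSpace.Completion.extensionHom g hg a) :=
    UniformSpace.Completion.continuous_extension
  { toFun := fun a : p.Completion => UniformSpace.Completion.extensionHom g hg a
    map_zero' := map_zero (UniformSpace.Completion.extensionHom g hg)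
    map_one' := map_one (UniformSpace.Completion.extensionHom g hg)
    map_add' := map_add (UniformSpace.Completion.extensionHom g hg)
    map_mul' := map_mul (UniformSpace.Completion.extensionHom g hg)
    commutes' := fun c => by
      rw [← coe_algebraMap, key, AlgHomClass.commutes]
    map_star' := fun a => by
      have hs := p.continuous_star_completion
      induction a using completion_induction with
      | hP => exact isClosed_eq (hc.comp hs) (continuous_star.comp hc)
      | h a => rw [← coe_star, key, key, map_star] }

theorem lift_coe {B : Type*} [CStarAlgebra B] (f : A →⋆ₐ[ℂ] B) (hf : ∀ a, ‖f a‖ ≤ p a) (a : A) :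
    p.lift f hf (p.coe a) = f a := by
  let g : p.Alg →+* B := (f : A →+* B)
  have hg : Continuous g :=
    (AddMonoidHomClass.lipschitz_of_bound g 1 (fun a => by simpa using! hf a)).continuous
  exact UniformSpace.Completion.extensionHom_coe g hg (p.toAlg a)

/-- The C*-seminorm `a ↦ ‖f a‖` defined by a *-homomorphism into a C*-algebra. -/
noncomputable def ofHom {B : Type*} [CStarAlgebra B] (f : A →⋆ₐ[ℂ] B) : CStarSeminorm A where
  toSeminorm := (normSeminorm ℂ B).comp (f : A →ₐ[ℂ] B).toLinearMap
  mul_le' a b := by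
    change ‖f (a * b)‖ ≤ ‖f a‖ * ‖f b‖
    rw [map_mul]
    exact norm_mul_le _ _
  star_mul_self' a := by
    change ‖f (star a * a)‖ = ‖f a‖ ^ 2
    rw [map_mul, map_star, CStarRing.norm_star_mul_self, sq]

theorem ofHom_apply {B : Type*} [CStarAlgebra B] (f : A →⋆ₐ[ℂ] B) (a : A) :
    ofHom f a = ‖f a‖ := rfl

variable [StarModule ℂ A]

instance : StarModule ℂ p.Completion where
  star_smul c a := by
    have hs := p.continuous_star_completion
    induction a using completion_induction with
    | hP => exact isClosed_eq (hs.comp (continuous_const_smul c)) (hs.const_smul (star c))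
    | h a => rw [← coe_smul, ← coe_star, star_smul, coe_smul, coe_star]

noncomputable instance : CStarAlgebra p.Completion where
  norm_mul_self_le a := by
    have hs := p.continuous_star_completion
    induction a using completion_induction with
    | hP => exact isClosed_le (by fun_prop) (by fun_prop)
    | h a => rw [← coe_star, ← map_mul, norm_coe, norm_coe, star_mul_self, sq]

end Basic

section Sup

variable {A : Type*} [Ring A] [StarRing A] [Algebra ℂ A]

open scoped Pointwise in
/-- The pointwise supremum of a pointwise bounded set of C*-seminorms. -/
noncomputable def sup (P : Set (CStarSeminorm A)) (hP : ∀ a, BddAbove ((fun p => p a) '' P)) :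
    CStarSeminorm A where
  toFun a := sSup ((fun p : CStarSeminorm A => p a) '' P)
  map_zero' := by
    apply le_antisymm
    · apply Real.sSup_le _ le_rfl
      rintro _ ⟨p, -, rfl⟩
      exact (map_zero p.toSeminorm).le
    · apply Real.sSup_nonneg
      rintro _ ⟨p, -, rfl⟩
      exact p.nonneg _
  add_le' a b := by
    have h0 : ∀ a : A, 0 ≤ sSup ((fun p : CStarSeminorm A => p a) '' P) := fun a =>
      Real.sSup_nonneg (by rintro _ ⟨p, -, rfl⟩; exact p.nonneg _)
    apply Real.sSup_le _ (add_nonneg (h0 a) (h0 b))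
    rintro _ ⟨p, hp, rfl⟩
    exact (map_add_le_add p.toSeminorm a b).trans
      (add_le_add (le_csSup (hP a) ⟨p, hp, rfl⟩) (le_csSup (hP b) ⟨p, hp, rfl⟩))
  neg' a := by
    congr 1
    apply Set.image_congr
    intro p _
    exact map_neg_eq_map p.toSeminorm a
  smul' c a := by
    have : (fun p : CStarSeminorm A => p (c • a)) '' P =
        ‖c‖ • ((fun p : CStarSeminorm A => p a) '' P) := by
      rw [← Set.image_smul, Set.image_image]
      exact Set.image_congr (fun p _ => map_smul_eq_mul p.toSeminorm c a)
    rw [this, Real.sSup_smul_of_nonneg (norm_nonneg c), smul_eq_mul]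
  mul_le' a b := by
    have h0 : ∀ a : A, 0 ≤ sSup ((fun p : CStarSeminorm A => p a) '' P) := fun a =>
      Real.sSup_nonneg (by rintro _ ⟨p, -, rfl⟩; exact p.nonneg _)
    apply Real.sSup_le _ (mul_nonneg (h0 a) (h0 b))
    rintro _ ⟨p, hp, rfl⟩
    exact (p.mul_le a b).trans (mul_le_mul (le_csSup (hP a) ⟨p, hp, rfl⟩)
      (le_csSup (hP b) ⟨p, hp, rfl⟩) (p.nonneg _) (h0 a))
  star_mul_self' a := by
    have h0 : ∀ a : A, 0 ≤ sSup ((fun p : CStarSeminorm A => p a) '' P) := fun a =>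
      Real.sSup_nonneg (by rintro _ ⟨p, -, rfl⟩; exact p.nonneg _)
    apply le_antisymm
    · apply Real.sSup_le _ (sq_nonneg _)
      rintro _ ⟨p, hp, rfl⟩
      change p (star a * a) ≤ _
      rw [p.star_mul_self]
      exact pow_le_pow_left₀ (p.nonneg _) (le_csSup (hP a) ⟨p, hp, rfl⟩) 2
    · rw [← Real.le_sqrt (h0 a) (h0 _)]
      apply Real.sSup_le _ (Real.sqrt_nonneg _)
      rintro _ ⟨p, hp, rfl⟩
      apply Real.le_sqrt_of_sq_le
      change p a ^ 2 ≤ _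
      rw [← p.star_mul_self]
      exact le_csSup (hP _) ⟨p, hp, rfl⟩

theorem sup_apply (P : Set (CStarSeminorm A)) (hP : ∀ a, BddAbove ((fun p => p a) '' P)) (a : A) :
    sup P hP a = sSup ((fun p : CStarSeminorm A => p a) '' P) := rfl

theorem le_sup (P : Set (CStarSeminorm A)) (hP : ∀ a, BddAbove ((fun p => p a) '' P))
    {p : CStarSeminorm A} (hp : p ∈ P) (a : A) : p a ≤ sup P hP a :=
  le_csSup (hP a) ⟨p, hp, rfl⟩

theorem sup_le (P : Set (CStarSeminorm A)) (hP : ∀ a, BddAbove ((fun p => p a) '' P))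
    {a : A} {r : ℝ} (hr : 0 ≤ r) (h : ∀ p ∈ P, p a ≤ r) : sup P hP a ≤ r :=
  Real.sSup_le (by rintro _ ⟨p, hp, rfl⟩; exact h p hp) hr

end Sup

end CStarSeminorm

/-! ### The free *-algebra on a set, and universal C*-algebras -/

/-- The free unital complex *-algebra on the set `S`: the free algebra on the generators
`s` (`Sum.inl s`) and their adjoints `s*` (`Sum.inr s`). -/
def FreeStarAlgebra (S : Type u) : Type u := FreeAlgebra ℂ (S ⊕ S)

namespace FreeStarAlgebra

variable {S : Type u}

noncomputable instance : Ring (FreeStarAlgebra S) := inferInstanceAs (Ring (FreeAlgebra ℂ (S ⊕ S)))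
noncomputable instance : Algebra ℂ (FreeStarAlgebra S) :=
  inferInstanceAs (Algebra ℂ (FreeAlgebra ℂ (S ⊕ S)))

/-- The generators and their adjoints. -/
noncomputable def gen (x : S ⊕ S) : FreeStarAlgebra S := FreeAlgebra.ι ℂ x

/-- The generator attached to `s`. -/
noncomputable def of (s : S) : FreeStarAlgebra S := gen (Sum.inl s)

/-- Induction on the construction of elements of the free *-algebra. -/
theorem induction {P : FreeStarAlgebra S → Prop} (hc : ∀ c : ℂ, P (algebraMap ℂ _ c))
    (hg : ∀ x, P (gen x)) (hm : ∀ a b, P a → P b → P (a * b)) (ha : ∀ a b, P a → P b → P (a + b))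
    (a : FreeStarAlgebra S) : P a :=
  FreeAlgebra.induction ℂ (S ⊕ S) (motive := P) hc hg hm ha a

/-- The opposite of the free *-algebra with the conjugate action of `ℂ`. -/
def ConjOp (S : Type u) : Type u := (FreeStarAlgebra S)ᵐᵒᵖ

noncomputable instance : Ring (ConjOp S) := inferInstanceAs (Ring (FreeStarAlgebra S)ᵐᵒᵖ)
noncomputable instance : Algebra ℂ (ConjOp S) :=
  Algebra.compHom (FreeStarAlgebra S)ᵐᵒᵖ (starRingEnd ℂ)

/-- The involution, as a homomorphism into the opposite conjugate algebra. It exchanges the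
generators `s` and `s*`. -/
noncomputable def starHom : FreeStarAlgebra S →ₐ[ℂ] ConjOp S :=
  FreeAlgebra.lift ℂ (fun x : S ⊕ S => (MulOpposite.op (gen x.swap) : (FreeStarAlgebra S)ᵐᵒᵖ))

noncomputable instance : Star (FreeStarAlgebra S) :=
  ⟨fun a => MulOpposite.unop (starHom a : (FreeStarAlgebra S)ᵐᵒᵖ)⟩

theorem star_gen (x : S ⊕ S) : star (gen x : FreeStarAlgebra S) = gen x.swap :=
  congrArg MulOpposite.unop (FreeAlgebra.lift_ι_apply (R := ℂ) (A := ConjOp S)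
    (fun x : S ⊕ S => (MulOpposite.op (gen x.swap) : (FreeStarAlgebra S)ᵐᵒᵖ)) x)

theorem star_algebraMap (c : ℂ) : star (algebraMap ℂ (FreeStarAlgebra S) c) =
    algebraMap ℂ (FreeStarAlgebra S) (star c) :=
  congrArg MulOpposite.unop ((starHom (S := S)).commutes c)

theorem star_mul_free (a b : FreeStarAlgebra S) : star (a * b) = star b * star a :=
  congrArg MulOpposite.unop (map_mul (starHom (S := S)) a b)

theorem star_add_free (a b : FreeStarAlgebra S) : star (a + b) = star a + star b :=
  congrArg MulOpposite.unop (map_add (starHom (S := S)) a b)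

noncomputable instance : StarRing (FreeStarAlgebra S) where
  star_involutive a := by
    induction a using induction with
    | hc c => rw [star_algebraMap, star_algebraMap, star_star]
    | hg x => rw [star_gen, star_gen, Sum.swap_swap]
    | hm a b ha hb => rw [star_mul_free, star_mul_free, ha, hb]
    | ha a b ha hb => rw [star_add_free, star_add_free, ha, hb]
  star_mul := star_mul_free
  star_add := star_add_free

instance : StarModule ℂ (FreeStarAlgebra S) where
  star_smul c a := by
    rw [Algebra.smul_def, Algebra.smul_def, star_mul, star_algebraMap]
    exact (Algebra.commutes _ _).symm

/-- The universal property of the free *-algebra. -/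
noncomputable def lift {B : Type*} [Ring B] [StarRing B] [Algebra ℂ B] [StarModule ℂ B]
    (f : S → B) : FreeStarAlgebra S →⋆ₐ[ℂ] B :=
  let g : FreeStarAlgebra S →ₐ[ℂ] B :=
    FreeAlgebra.lift ℂ (Sum.elim f (fun s => star (f s)))
  have hgen : ∀ x, g (gen x) = Sum.elim f (fun s => star (f s)) x := fun x =>
    FreeAlgebra.lift_ι_apply _ x
  { g with
    map_star' := fun a => by
      change g (star a) = star (g a)
      induction a using induction with
      | hc c => rw [star_algebraMap, g.commutes, g.commutes, algebraMap_star_comm]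
      | hg x => cases x <;> simp [star_gen, hgen]
      | hm a b ha hb => rw [star_mul, map_mul, map_mul, star_mul, ha, hb]
      | ha a b ha hb => rw [star_add, map_add, map_add, star_add, ha, hb] }

theorem lift_of {B : Type*} [Ring B] [StarRing B] [Algebra ℂ B] [StarModule ℂ B]
    (f : S → B) (s : S) : lift f (of s) = f s :=
  FreeAlgebra.lift_ι_apply (R := ℂ) (Sum.elim f (fun s => star (f s))) (Sum.inl s)

end FreeStarAlgebra

namespace UniversalCStar

variable {S : Type u}

/-- The C*-seminorms on the free *-algebra that vanish on a set `R` of relations. -/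
def admissible (R : Set (FreeStarAlgebra S)) : Set (CStarSeminorm (FreeStarAlgebra S)) :=
  {p | ∀ r ∈ R, p r = 0}

/-- The relations `R` bound the generators. This is the standard condition
for the universal C*-algebra with generators `S` and relations `R` to exist. -/
def IsBounded (R : Set (FreeStarAlgebra S)) : Prop :=
  ∀ s : S, BddAbove ((fun p => p (FreeStarAlgebra.of s)) '' admissible R)

theorem IsBounded.bddAbove {R : Set (FreeStarAlgebra S)} (hR : IsBounded R)
    (a : FreeStarAlgebra S) : BddAbove ((fun p => p a) '' admissible R) := by
  have one_le : ∀ p : CStarSeminorm (FreeStarAlgebra S), p 1 ≤ 1 := by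
    intro p
    have h := p.star_mul_self 1
    rw [star_one, one_mul] at h
    nlinarith [p.nonneg 1, sq_nonneg (p 1 - 1)]
  induction a using FreeStarAlgebra.induction with
  | hc c =>
    refine ⟨‖c‖, ?_⟩
    rintro _ ⟨p, -, rfl⟩
    change p _ ≤ _
    rw [Algebra.algebraMap_eq_smul_one, map_smul_eq_mul]
    exact mul_le_of_le_one_right (norm_nonneg c) (one_le p)
  | hg x =>
    cases x with
    | inl s => exact hR s
    | inr s =>
      obtain ⟨M, hM⟩ := hR s
      refine ⟨M, ?_⟩
      rintro _ ⟨p, hp, rfl⟩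
      have h1 : star (FreeStarAlgebra.of s) = FreeStarAlgebra.gen (Sum.inr s) :=
        FreeStarAlgebra.star_gen _
      change p _ ≤ _
      rw [← h1, p.star_eq]
      exact hM ⟨p, hp, rfl⟩
  | hm a b ha hb =>
    obtain ⟨M, hM⟩ := ha
    obtain ⟨N, hN⟩ := hb
    refine ⟨M * N, ?_⟩
    rintro _ ⟨p, hp, rfl⟩
    have h1 : p a ≤ M := hM ⟨p, hp, rfl⟩
    have h2 : p b ≤ N := hN ⟨p, hp, rfl⟩
    exact (p.mul_le a b).trans
      (mul_le_mul h1 h2 (p.nonneg b) ((p.nonneg a).trans h1))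
  | ha a b ha hb =>
    obtain ⟨M, hM⟩ := ha
    obtain ⟨N, hN⟩ := hb
    refine ⟨M + N, ?_⟩
    rintro _ ⟨p, hp, rfl⟩
    have h1 : p a ≤ M := hM ⟨p, hp, rfl⟩
    have h2 : p b ≤ N := hN ⟨p, hp, rfl⟩
    exact (map_add_le_add p.toSeminorm a b).trans (add_le_add h1 h2)

/-- The largest C*-seminorm on the free *-algebra that vanishes on the relations. -/
noncomputable def seminorm (R : Set (FreeStarAlgebra S)) (hR : IsBounded R) :
    CStarSeminorm (FreeStarAlgebra S) :=
  CStarSeminorm.sup (admissible R) hR.bddAbove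

end UniversalCStar

/-- The universal (unital) C*-algebra with generators `S` and relations `r = 0`, `r ∈ R`. -/
abbrev UniversalCStar {S : Type u} (R : Set (FreeStarAlgebra S))
    (hR : UniversalCStar.IsBounded R) : Type u :=
  (UniversalCStar.seminorm R hR).Completion

namespace UniversalCStar

variable {S : Type u} (R : Set (FreeStarAlgebra S)) (hR : IsBounded R)

/-- The canonical map of the free *-algebra into the universal C*-algebra. -/
noncomputable def mk : FreeStarAlgebra S →⋆ₐ[ℂ] UniversalCStar R hR := (seminorm R hR).coe

/-- The generators of the universal C*-algebra. -/
noncomputable def gen (s : S) : UniversalCStar R hR := mk R hR (FreeStarAlgebra.of s)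

theorem mk_eq_zero {r : FreeStarAlgebra S} (hr : r ∈ R) : mk R hR r = 0 := by
  rw [← norm_eq_zero, mk, CStarSeminorm.norm_coe_apply]
  exact le_antisymm (CStarSeminorm.sup_le _ _ le_rfl (fun p hp => (hp r hr).le))
    (CStarSeminorm.nonneg _ _)

/-- Elements of a C*-algebra satisfying the relations define a *-homomorphism on the universal
C*-algebra. -/
noncomputable def lift {B : Type*} [CStarAlgebra B] (f : S → B)
    (hf : ∀ r ∈ R, FreeStarAlgebra.lift f r = 0) : UniversalCStar R hR →⋆ₐ[ℂ] B :=
  (seminorm R hR).lift (FreeStarAlgebra.lift f) (fun a =>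
    CStarSeminorm.le_sup (admissible R) hR.bddAbove
      (p := CStarSeminorm.ofHom (FreeStarAlgebra.lift f))
      (fun r hr => by rw [CStarSeminorm.ofHom_apply, hf r hr, norm_zero]) a)

theorem lift_mk {B : Type*} [CStarAlgebra B] (f : S → B)
    (hf : ∀ r ∈ R, FreeStarAlgebra.lift f r = 0) (a : FreeStarAlgebra S) :
    lift R hR f hf (mk R hR a) = FreeStarAlgebra.lift f a :=
  CStarSeminorm.lift_coe _ _ _ _

theorem lift_gen {B : Type*} [CStarAlgebra B] (f : S → B)
    (hf : ∀ r ∈ R, FreeStarAlgebra.lift f r = 0) (s : S) :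
    lift R hR f hf (gen R hR s) = f s := by
  rw [gen, lift_mk, FreeStarAlgebra.lift_of]

/-- The generators generate the universal C*-algebra topologically. -/
theorem topologicalClosure_adjoin_gen :
    (StarAlgebra.adjoin ℂ (Set.range (gen R hR))).topologicalClosure = ⊤ := by
  rw [eq_top_iff]
  rintro a -
  have h : ∀ a, mk R hR a ∈ StarAlgebra.adjoin ℂ (Set.range (gen R hR)) := by
    intro a
    induction a using FreeStarAlgebra.induction with
    | hc c => rw [AlgHomClass.commutes]; exact algebraMap_mem _ c
    | hg x =>
      cases x with
      | inl s => exact StarAlgebra.subset_adjoin ℂ _ ⟨s, rfl⟩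
      | inr s =>
        have h1 : star (FreeStarAlgebra.of s) = FreeStarAlgebra.gen (Sum.inr s) :=
          FreeStarAlgebra.star_gen _
        rw [← h1, map_star]
        exact star_mem (StarAlgebra.subset_adjoin ℂ _ ⟨s, rfl⟩)
    | hm a b ha hb => rw [map_mul]; exact mul_mem ha hb
    | ha a b ha hb => rw [map_add]; exact add_mem ha hb
  exact (seminorm R hR).induction_on a isClosed_closure (fun a => subset_closure (h a))

end UniversalCStar

/-! ### The minimal (spatial) tensor product of C*-algebras -/

namespace MinTensor

variable {A B : Type u} [CStarAlgebra A] [CStarAlgebra B]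

section Rep

variable {H K : Type u} [NormedAddCommGroup H] [InnerProductSpace ℂ H] [CompleteSpace H]
  [NormedAddCommGroup K] [InnerProductSpace ℂ K] [CompleteSpace K]

theorem norm_inner_self {E : Type*} [NormedAddCommGroup E] [InnerProductSpace ℂ E] (v : E) :
    ‖(inner ℂ v v : ℂ)‖ = ‖v‖ ^ 2 := by
  rw [inner_self_eq_norm_sq_to_K]
  simp

/-- The representation `π ⊗ ρ` of the algebraic tensor product on the (pre-)Hilbert space `H ⊗ K`,
`(π ⊗ ρ) (a ⊗ b) = π a ⊗ ρ b`, for representations `π` on `H` and `ρ` on `K`. -/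
noncomputable def rep (π : A →⋆ₐ[ℂ] (H →L[ℂ] H)) (ρ : B →⋆ₐ[ℂ] (K →L[ℂ] K)) :
    A ⊗[ℂ] B →ₐ[ℂ] (H ⊗[ℂ] K →L[ℂ] H ⊗[ℂ] K) :=
  Algebra.TensorProduct.lift
    (AlgHom.ofLinearMap
      { toFun := fun a => (π a).rTensor K
        map_add' := fun a b => by rw [map_add, ContinuousLinearMap.rTensor_add]
        map_smul' := fun c a => by rw [map_smul, ContinuousLinearMap.rTensor_smul]; rfl }
      (by simp) (fun a b => by simp [ContinuousLinearMap.rTensor_mul]))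
    (AlgHom.ofLinearMap
      { toFun := fun b => (ρ b).lTensor H
        map_add' := fun a b => by rw [map_add, ContinuousLinearMap.lTensor_add]
        map_smul' := fun c a => by rw [map_smul, ContinuousLinearMap.lTensor_smul]; rfl }
      (by simp) (fun a b => by simp [ContinuousLinearMap.lTensor_mul]))
    (fun a b => ((π a).rTensor_comp_lTensor (ρ b)).trans ((ρ b).lTensor_comp_rTensor (π a)).symm)

theorem rep_tmul (π : A →⋆ₐ[ℂ] (H →L[ℂ] H)) (ρ : B →⋆ₐ[ℂ] (K →L[ℂ] K)) (a : A) (b : B) :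
    rep π ρ (a ⊗ₜ b) = TensorProduct.mapL (π a) (ρ b) :=
  (Algebra.TensorProduct.lift_tmul _ _ _ a b).trans ((π a).rTensor_comp_lTensor (ρ b))

theorem inner_rep_star (π : A →⋆ₐ[ℂ] (H →L[ℂ] H)) (ρ : B →⋆ₐ[ℂ] (K →L[ℂ] K)) (x : A ⊗[ℂ] B)
    (v w : H ⊗[ℂ] K) : inner ℂ (rep π ρ (star x) v) w = inner ℂ v (rep π ρ x w) := by
  induction x with
  | zero => simp
  | add x y hx hy =>
    rw [star_add, map_add, map_add, add_apply, add_apply,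
      inner_add_left, inner_add_right, hx, hy]
  | tmul a b =>
    rw [TensorProduct.star_tmul, rep_tmul, rep_tmul]
    induction v with
    | zero => simp
    | add v v' hv hv' => rw [map_add, inner_add_left, inner_add_left, hv, hv']
    | tmul h k =>
      induction w with
      | zero => simp
      | add w w' hw hw' => rw [map_add, inner_add_right, inner_add_right, hw, hw']
      | tmul h' k' =>
        rw [TensorProduct.mapL_tmul, TensorProduct.mapL_tmul, TensorProduct.inner_tmul,
          TensorProduct.inner_tmul, map_star, map_star, ContinuousLinearMap.star_eq_adjoint,
          ContinuousLinearMap.star_eq_adjoint, ContinuousLinearMap.adjoint_inner_left,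
          ContinuousLinearMap.adjoint_inner_left]

theorem norm_rep_nonneg (π : A →⋆ₐ[ℂ] (H →L[ℂ] H)) (ρ : B →⋆ₐ[ℂ] (K →L[ℂ] K)) (x : A ⊗[ℂ] B) :
    0 ≤ ‖rep π ρ x‖ := ContinuousLinearMap.opNorm_nonneg _

theorem norm_rep_mul_le (π : A →⋆ₐ[ℂ] (H →L[ℂ] H)) (ρ : B →⋆ₐ[ℂ] (K →L[ℂ] K)) (x y : A ⊗[ℂ] B) :
    ‖rep π ρ (x * y)‖ ≤ ‖rep π ρ x‖ * ‖rep π ρ y‖ := by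
  rw [map_mul]; exact ContinuousLinearMap.opNorm_comp_le _ _

theorem norm_rep_le_star (π : A →⋆ₐ[ℂ] (H →L[ℂ] H)) (ρ : B →⋆ₐ[ℂ] (K →L[ℂ] K)) (x : A ⊗[ℂ] B) :
    ‖rep π ρ x‖ ^ 2 ≤ ‖rep π ρ (star x * x)‖ := by
  have h : ‖rep π ρ x‖ ≤ Real.sqrt ‖rep π ρ (star x * x)‖ := by
    refine ContinuousLinearMap.opNorm_le_bound _ (Real.sqrt_nonneg _) (fun v => ?_)
    rw [← Real.sqrt_sq (norm_nonneg v), ← Real.sqrt_mul (norm_rep_nonneg π ρ _)]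
    apply Real.le_sqrt_of_sq_le
    have h1 : ‖rep π ρ x v‖ ^ 2 = ‖inner ℂ (rep π ρ (star x * x) v) v‖ := by
      have h2 := inner_rep_star π ρ x (rep π ρ x v) v
      rw [map_mul, mul_apply_eq_comp, h2]
      exact (norm_inner_self _).symm
    rw [h1, sq ‖v‖, ← mul_assoc]
    exact (norm_inner_le_norm _ _).trans
      (mul_le_mul_of_nonneg_right (ContinuousLinearMap.le_opNorm _ _) (norm_nonneg _))
  calc ‖rep π ρ x‖ ^ 2 ≤ Real.sqrt ‖rep π ρ (star x * x)‖ ^ 2 :=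
        pow_le_pow_left₀ (norm_rep_nonneg π ρ _) h 2
    _ = _ := Real.sq_sqrt (norm_rep_nonneg π ρ _)

/-- The C*-seminorm `x ↦ ‖(π ⊗ ρ) x‖` on the algebraic tensor product. -/
noncomputable def repSeminorm (π : A →⋆ₐ[ℂ] (H →L[ℂ] H)) (ρ : B →⋆ₐ[ℂ] (K →L[ℂ] K)) :
    CStarSeminorm (A ⊗[ℂ] B) where
  toSeminorm := (normSeminorm ℂ (H ⊗[ℂ] K →L[ℂ] H ⊗[ℂ] K)).comp (rep π ρ).toLinearMap
  mul_le' x y := by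
    change ‖rep π ρ (x * y)‖ ≤ ‖rep π ρ x‖ * ‖rep π ρ y‖
    exact norm_rep_mul_le π ρ x y
  star_mul_self' x := by
    change ‖rep π ρ (star x * x)‖ = ‖rep π ρ x‖ ^ 2
    refine le_antisymm ?_ (norm_rep_le_star π ρ x)
    have h1 : ∀ y, ‖rep π ρ (star y * y)‖ ≤ ‖rep π ρ (star y)‖ * ‖rep π ρ y‖ := fun y =>
      norm_rep_mul_le π ρ (star y) y
    have h2 : ∀ y, ‖rep π ρ y‖ ≤ ‖rep π ρ (star y)‖ := by
      intro y
      rcases (norm_rep_nonneg π ρ y).eq_or_lt with h | h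
      · rw [← h]; exact norm_rep_nonneg π ρ _
      · have h3 := (norm_rep_le_star π ρ y).trans (h1 y)
        rw [sq] at h3
        exact le_of_mul_le_mul_right h3 h
    have h4 : ‖rep π ρ (star x)‖ ≤ ‖rep π ρ x‖ := by simpa using h2 (star x)
    rw [sq]
    exact (h1 x).trans (mul_le_mul_of_nonneg_right h4 (norm_rep_nonneg π ρ x))

theorem repSeminorm_apply (π : A →⋆ₐ[ℂ] (H →L[ℂ] H)) (ρ : B →⋆ₐ[ℂ] (K →L[ℂ] K))
    (x : A ⊗[ℂ] B) : repSeminorm π ρ x = ‖rep π ρ x‖ := rfl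

theorem repSeminorm_tmul_le (π : A →⋆ₐ[ℂ] (H →L[ℂ] H)) (ρ : B →⋆ₐ[ℂ] (K →L[ℂ] K))
    (a : A) (b : B) : repSeminorm π ρ (a ⊗ₜ b) ≤ ‖a‖ * ‖b‖ := by
  rw [repSeminorm_apply, rep_tmul]
  exact (TensorProduct.norm_mapL_le _ _).trans
    (mul_le_mul (NonUnitalStarAlgHom.norm_apply_le π a) (NonUnitalStarAlgHom.norm_apply_le ρ b)
      (norm_nonneg _) (norm_nonneg _))

end Rep

variable (A B) in
/-- All C*-seminorms `x ↦ ‖(π ⊗ ρ) x‖`, where `π` and `ρ` are representations of `A` and `B` on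
Hilbert spaces. -/
def spatialSeminorms : Set (CStarSeminorm (A ⊗[ℂ] B)) :=
  {p | ∃ (H K : Type u) (_ : NormedAddCommGroup H) (_ : InnerProductSpace ℂ H)
    (_ : CompleteSpace H) (_ : NormedAddCommGroup K) (_ : InnerProductSpace ℂ K)
    (_ : CompleteSpace K) (π : A →⋆ₐ[ℂ] (H →L[ℂ] H)) (ρ : B →⋆ₐ[ℂ] (K →L[ℂ] K)),
    p = repSeminorm π ρ}

theorem bddAbove_spatialSeminorms (x : A ⊗[ℂ] B) :
    BddAbove ((fun p => p x) '' spatialSeminorms A B) := by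
  induction x with
  | zero =>
    refine ⟨0, ?_⟩
    rintro _ ⟨p, -, rfl⟩
    exact (map_zero p.toSeminorm).le
  | tmul a b =>
    refine ⟨‖a‖ * ‖b‖, ?_⟩
    rintro _ ⟨p, ⟨H, K, _, _, _, _, _, _, π, ρ, rfl⟩, rfl⟩
    exact repSeminorm_tmul_le π ρ a b
  | add x y hx hy =>
    obtain ⟨M, hM⟩ := hx
    obtain ⟨N, hN⟩ := hy
    refine ⟨M + N, ?_⟩
    rintro _ ⟨p, hp, rfl⟩
    have h1 : p x ≤ M := hM ⟨p, hp, rfl⟩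
    have h2 : p y ≤ N := hN ⟨p, hp, rfl⟩
    exact (map_add_le_add p.toSeminorm x y).trans (add_le_add h1 h2)

variable (A B) in
/-- The minimal (spatial) C*-norm `‖x‖ = sup ‖(π ⊗ ρ) x‖` on the algebraic tensor product. -/
noncomputable def seminorm : CStarSeminorm (A ⊗[ℂ] B) :=
  CStarSeminorm.sup (spatialSeminorms A B) bddAbove_spatialSeminorms

end MinTensor

/-- The minimal tensor product of two unital C*-algebras. -/
abbrev MinTensor (A B : Type u) [CStarAlgebra A] [CStarAlgebra B] : Type u :=
  (MinTensor.seminorm A B).Completion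

namespace MinTensor

variable {A B : Type u} [CStarAlgebra A] [CStarAlgebra B]

/-- The canonical map from the algebraic to the minimal tensor product. -/
noncomputable def incl : A ⊗[ℂ] B →⋆ₐ[ℂ] MinTensor A B := (seminorm A B).coe

/-- The elementary tensor `a ⊗ b` in the minimal tensor product. -/
noncomputable def tmul (a : A) (b : B) : MinTensor A B := incl (a ⊗ₜ b)

/-- The algebraic tensor product of two *-homomorphisms. -/
noncomputable def algMap {A' B' : Type u} [CStarAlgebra A'] [CStarAlgebra B'] (φ : A →⋆ₐ[ℂ] A')
    (ψ : B →⋆ₐ[ℂ] B') : A ⊗[ℂ] B →⋆ₐ[ℂ] A' ⊗[ℂ] B' where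
  __ := Algebra.TensorProduct.map (φ : A →ₐ[ℂ] A') (ψ : B →ₐ[ℂ] B')
  map_star' x := by
    change Algebra.TensorProduct.map (φ : A →ₐ[ℂ] A') (ψ : B →ₐ[ℂ] B') (star x) =
      star (Algebra.TensorProduct.map (φ : A →ₐ[ℂ] A') (ψ : B →ₐ[ℂ] B') x)
    induction x with
    | zero => simp
    | tmul a b => simp [map_star]
    | add x y hx hy => rw [star_add, map_add, map_add, star_add, hx, hy]

theorem algMap_tmul {A' B' : Type u} [CStarAlgebra A'] [CStarAlgebra B'] (φ : A →⋆ₐ[ℂ] A')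
    (ψ : B →⋆ₐ[ℂ] B') (a : A) (b : B) : algMap φ ψ (a ⊗ₜ b) = φ a ⊗ₜ ψ b := rfl

theorem seminorm_algMap_le {A' B' : Type u} [CStarAlgebra A'] [CStarAlgebra B'] (φ : A →⋆ₐ[ℂ] A')
    (ψ : B →⋆ₐ[ℂ] B') (x : A ⊗[ℂ] B) : seminorm A' B' (algMap φ ψ x) ≤ seminorm A B x := by
  refine CStarSeminorm.sup_le _ _ (CStarSeminorm.nonneg _ _) ?_
  rintro p ⟨H, K, _, _, _, _, _, _, π, ρ, rfl⟩
  have h : ∀ x, rep π ρ (algMap φ ψ x) = rep (π.comp φ) (ρ.comp ψ) x := by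
    intro x
    induction x with
    | zero => simp
    | tmul a b => rw [algMap_tmul, rep_tmul, rep_tmul]; rfl
    | add x y hx hy => rw [map_add, map_add, map_add, hx, hy]
  rw [repSeminorm_apply, h, ← repSeminorm_apply]
  exact CStarSeminorm.le_sup _ bddAbove_spatialSeminorms
    ⟨H, K, _, _, _, _, _, _, π.comp φ, ρ.comp ψ, rfl⟩ x

/-- The tensor product `φ ⊗ ψ` of two *-homomorphisms on minimal tensor products. -/
noncomputable def map {A' B' : Type u} [CStarAlgebra A'] [CStarAlgebra B'] (φ : A →⋆ₐ[ℂ] A')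
    (ψ : B →⋆ₐ[ℂ] B') : MinTensor A B →⋆ₐ[ℂ] MinTensor A' B' :=
  (seminorm A B).lift (incl.comp (algMap φ ψ)) (fun x => by
    change ‖(seminorm A' B').coe (algMap φ ψ x)‖ ≤ _
    rw [CStarSeminorm.norm_coe_apply]
    exact seminorm_algMap_le φ ψ x)

theorem map_tmul {A' B' : Type u} [CStarAlgebra A'] [CStarAlgebra B'] (φ : A →⋆ₐ[ℂ] A')
    (ψ : B →⋆ₐ[ℂ] B') (a : A) (b : B) : map φ ψ (tmul a b) = tmul (φ a) (ψ b) :=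
  CStarSeminorm.lift_coe _ _ _ _

theorem tmul_mul_tmul (a a' : A) (b b' : B) :
    tmul a b * tmul a' b' = tmul (a * a') (b * b') := by
  rw [tmul, tmul, tmul, ← map_mul, Algebra.TensorProduct.tmul_mul_tmul]

theorem star_tmul (a : A) (b : B) : star (tmul a b) = tmul (star a) (star b) := by
  rw [tmul, tmul, ← map_star, TensorProduct.star_tmul]

theorem one_tmul_one : tmul (1 : A) (1 : B) = 1 := by
  rw [tmul, ← Algebra.TensorProduct.one_def, map_one]

theorem zero_tmul (b : B) : tmul (0 : A) b = 0 := by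
  rw [tmul, TensorProduct.zero_tmul, map_zero]

theorem tmul_zero (a : A) : tmul a (0 : B) = 0 := by
  rw [tmul, TensorProduct.tmul_zero, map_zero]

theorem sum_tmul {ι : Type*} (s : Finset ι) (f : ι → A) (b : B) :
    tmul (∑ i ∈ s, f i) b = ∑ i ∈ s, tmul (f i) b := by
  simp_rw [tmul]
  rw [TensorProduct.sum_tmul, map_sum]

theorem tmul_sum {ι : Type*} (s : Finset ι) (a : A) (f : ι → B) :
    tmul a (∑ i ∈ s, f i) = ∑ i ∈ s, tmul a (f i) := by
  simp_rw [tmul]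
  rw [TensorProduct.tmul_sum, map_sum]

end MinTensor

/-! ### Compact matrix quantum groups -/

/-- A compact matrix quantum group `(C(G), u)` with fundamental representation `u` indexed by `ι`:
`C(G)` is a unital C*-algebra generated by the entries of `u`, the matrices `[u i j]` and
`[(u i j)*]` are invertible, and `Δ (u i j) = ∑ k, u i k ⊗ u k j` defines a unital *-homomorphism
`Δ : C(G) → C(G) ⊗ C(G)` into the minimal tensor product. -/
structure CompactMatrixQuantumGroup (ι : Type u) [Fintype ι] [DecidableEq ι] where
  /-- The C*-algebra `C(G)`. -/
  Carrier : Type u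
  [cstar : CStarAlgebra Carrier]
  /-- The fundamental representation `u`. -/
  fund : Matrix ι ι Carrier
  generates : (StarAlgebra.adjoin ℂ
    (Set.range fun ij : ι × ι => fund ij.1 ij.2)).topologicalClosure = ⊤
  isUnit_fund : IsUnit fund
  isUnit_conj : IsUnit (fund.map star)
  /-- The comultiplication `Δ`. -/
  comul : Carrier →⋆ₐ[ℂ] MinTensor Carrier Carrier
  comul_fund : ∀ i j, comul (fund i j) = ∑ k, MinTensor.tmul (fund i k) (fund k j)

attribute [instance] CompactMatrixQuantumGroup.cstar

/-- Two compact matrix quantum groups are the same if there is a *-isomorphism of their C*-algebras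
that carries one fundamental representation to the other and intertwines the comultiplications. -/
def CompactMatrixQuantumGroup.Same {ι : Type u} [Fintype ι] [DecidableEq ι]
    (G H : CompactMatrixQuantumGroup ι) : Prop :=
  ∃ φ : G.Carrier ≃⋆ₐ[ℂ] H.Carrier, (∀ i j, φ (G.fund i j) = H.fund i j) ∧
    ∀ a, H.comul (φ a) =
      MinTensor.map (φ : G.Carrier →⋆ₐ[ℂ] H.Carrier) (φ : G.Carrier →⋆ₐ[ℂ] H.Carrier) (G.comul a)

/-! ### Magic unitaries -/

/-- A magic unitary: a matrix of projections (in a *-algebra) whose rows and columns sum to `1`. -/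
structure IsMagicUnitary {ι κ A : Type*} [Fintype ι] [Fintype κ] [Ring A] [StarRing A]
    (w : Matrix ι κ A) : Prop where
  star_eq : ∀ i j, star (w i j) = w i j
  mul_self : ∀ i j, w i j * w i j = w i j
  sum_row : ∀ i, ∑ j, w i j = 1
  sum_col : ∀ j, ∑ i, w i j = 1

/-- Projections in a C*-algebra with sum `1` are pairwise orthogonal. -/
theorem mul_eq_zero_of_sum_eq_one {ι A : Type*} [Fintype ι] [CStarAlgebra A] (q : ι → A)
    (hs : ∀ i, star (q i) = q i) (hm : ∀ i, q i * q i = q i) (h1 : ∑ i, q i = 1) {i j : ι}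
    (hij : i ≠ j) : q i * q j = 0 := by
  classical
  let _ := CStarAlgebra.spectralOrder A
  have := CStarAlgebra.spectralOrderedRing A
  have h2 : ∑ k, q j * q k * q j = q j := by
    rw [← Finset.sum_mul, ← Finset.mul_sum, h1, mul_one, hm]
  rw [← Finset.add_sum_erase _ _ (Finset.mem_univ j), hm, hm, add_eq_left] at h2
  have h3 : ∀ k, q j * q k * q j = star (q k * q j) * (q k * q j) := fun k => by
    rw [star_mul, hs, hs, mul_assoc, mul_assoc, ← mul_assoc (q k) (q k), hm]
  rw [Finset.sum_eq_zero_iff_of_nonneg (fun k _ => by rw [h3]; exact star_mul_self_nonneg _)] at h2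
  have h4 := h2 i (Finset.mem_erase.2 ⟨hij, Finset.mem_univ _⟩)
  rw [h3] at h4
  exact CStarRing.star_mul_self_eq_zero_iff _ |>.1 h4

namespace IsMagicUnitary

variable {ι A : Type*} [Fintype ι] [CStarAlgebra A] {w : Matrix ι ι A}

theorem row_orthogonal (hw : IsMagicUnitary w) {i j k : ι} (h : j ≠ k) : w i j * w i k = 0 :=
  mul_eq_zero_of_sum_eq_one (fun j => w i j) (hw.star_eq i) (hw.mul_self i) (hw.sum_row i) h

theorem col_orthogonal (hw : IsMagicUnitary w) {i j k : ι} (h : j ≠ k) : w j i * w k i = 0 :=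
  mul_eq_zero_of_sum_eq_one (fun j => w j i) (fun j => hw.star_eq j i) (fun j => hw.mul_self j i)
    (hw.sum_col i) h

theorem isUnit [DecidableEq ι] (hw : IsMagicUnitary w) : IsUnit w := by
  refine ⟨⟨w, w.transpose, ?_, ?_⟩, rfl⟩
  · ext i j
    rw [Matrix.mul_apply, Matrix.one_apply]
    simp only [Matrix.transpose_apply]
    split_ifs with h
    · subst h; simp_rw [hw.mul_self]; exact hw.sum_row i
    · exact Finset.sum_eq_zero (fun k _ => hw.col_orthogonal h)
  · ext i j
    rw [Matrix.mul_apply, Matrix.one_apply]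
    simp only [Matrix.transpose_apply]
    split_ifs with h
    · subst h; simp_rw [hw.mul_self]; exact hw.sum_col i
    · exact Finset.sum_eq_zero (fun k _ => hw.row_orthogonal h)

theorem map_star_eq (hw : IsMagicUnitary w) : w.map star = w := by
  ext i j; exact hw.star_eq i j

end IsMagicUnitary

/-! ### Colored graphs -/

/-- A (simple) vertex-colored graph on the vertex set `V` with colors in `C`. -/
structure ColoredGraph (V C : Type*) where
  /-- The underlying graph. -/
  graph : SimpleGraph V
  /-- The coloring; adjacent vertices may have the same color. -/
  color : V → C

namespace ColoredGraph

/-- The disjoint union of a family of colored graphs. -/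
def disjointUnion {I C : Type*} {V : I → Type*} (X : ∀ i, ColoredGraph (V i) C) :
    ColoredGraph (Σ i, V i) C where
  graph :=
    { Adj := fun x y => ∃ (i : I) (a b : V i), (X i).graph.Adj a b ∧ x = ⟨i, a⟩ ∧ y = ⟨i, b⟩
      symm := ⟨by rintro _ _ ⟨i, a, b, h, rfl, rfl⟩; exact ⟨i, b, a, h.symm, rfl, rfl⟩⟩
      loopless := ⟨by
        rintro _ ⟨i, a, b, h, rfl, h'⟩
        cases h'
        exact h.ne rfl⟩ }
  color := fun x => (X x.1).color x.2

/-- A connected component of a colored graph, as a colored graph on its own vertex set. -/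
def component {V C : Type*} (X : ColoredGraph V C) (K : X.graph.ConnectedComponent) :
    ColoredGraph K C where
  graph := K.toSimpleGraph
  color := fun x => X.color x

open Classical in
/-- Quantum isomorphism of finite colored graphs: there is a magic unitary `u`, indexed by
`V(X) × V(Y)` and with entries in a nonzero unital C*-algebra, such that `A_X u = u A_Y` and
`u x y = 0` whenever `x` and `y` have different colors. -/
def QuantumIsomorphic {V W : Type u} {C : Type*} [Fintype V] [Fintype W] (X : ColoredGraph V C)
    (Y : ColoredGraph W C) : Prop :=
  ∃ (A : Type u) (_ : CStarAlgebra A) (_ : Nontrivial A) (w : Matrix V W A),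
    IsMagicUnitary w ∧ X.graph.adjMatrix A * w = w * Y.graph.adjMatrix A ∧
      ∀ x y, X.color x ≠ Y.color y → w x y = 0

noncomputable instance componentFintype {V C : Type*} [Fintype V] (X : ColoredGraph V C)
    (K : X.graph.ConnectedComponent) : Fintype K := Fintype.ofFinite K

/-! ### The quantum automorphism group of a colored graph -/

section Qut

variable {V : Type u} {C : Type*} [Fintype V] (X : ColoredGraph V C)

/-- The defining relations (`r = 0`) of the quantum automorphism group of a colored graph. -/
inductive QutRel : FreeStarAlgebra (V × V) → Prop
  | star_eq (i j : V) : QutRel (star (FreeStarAlgebra.of (i, j)) - FreeStarAlgebra.of (i, j))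
  | mul_self (i j : V) : QutRel
      (FreeStarAlgebra.of (i, j) * FreeStarAlgebra.of (i, j) - FreeStarAlgebra.of (i, j))
  | sum_row (i : V) : QutRel (∑ k, FreeStarAlgebra.of (i, k) - 1)
  | sum_col (j : V) : QutRel (∑ k, FreeStarAlgebra.of (k, j) - 1)
  | adj_left (i j k l : V) : X.graph.Adj i k → ¬ X.graph.Adj j l →
      QutRel (FreeStarAlgebra.of (i, j) * FreeStarAlgebra.of (k, l))
  | adj_right (i j k l : V) : ¬ X.graph.Adj i k → X.graph.Adj j l →
      QutRel (FreeStarAlgebra.of (i, j) * FreeStarAlgebra.of (k, l))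
  | color (i j : V) : X.color i ≠ X.color j → QutRel (FreeStarAlgebra.of (i, j))

/-- The set of defining relations of the quantum automorphism group. -/
def qutRelations : Set (FreeStarAlgebra (V × V)) := {r | X.QutRel r}

theorem isBounded_qutRelations : UniversalCStar.IsBounded X.qutRelations := by
  rintro ⟨i, j⟩
  refine ⟨1, ?_⟩
  rintro _ ⟨p, hp, rfl⟩
  have h0 : ∀ r, X.QutRel r → p.coe r = 0 := fun r hr => by
    rw [← norm_eq_zero, p.norm_coe_apply]; exact hp r hr
  have h1 := h0 _ (QutRel.star_eq i j)
  have h2 := h0 _ (QutRel.mul_self i j)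
  rw [map_sub, sub_eq_zero] at h1 h2
  rw [map_star] at h1
  rw [map_mul] at h2
  change p _ ≤ 1
  rw [← p.norm_coe_apply]
  exact IsStarProjection.norm_le _ ⟨h2, h1⟩

/-- The universal C*-algebra `C(Qut_c(X))`. -/
abbrev QutAlgebra : Type u := UniversalCStar X.qutRelations X.isBounded_qutRelations

/-- The generators `u i j` of `C(Qut_c(X))`. -/
noncomputable def qutFund : Matrix V V X.QutAlgebra :=
  Matrix.of fun i j => UniversalCStar.gen X.qutRelations X.isBounded_qutRelations (i, j)

/-- The matrices over a C*-algebra that satisfy the defining relations of `Qut_c(X)`. -/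
structure IsQutMatrix {A : Type*} [CStarAlgebra A] (w : Matrix V V A) : Prop where
  magic : IsMagicUnitary w
  adj_left : ∀ i j k l, X.graph.Adj i k → ¬ X.graph.Adj j l → w i j * w k l = 0
  adj_right : ∀ i j k l, ¬ X.graph.Adj i k → X.graph.Adj j l → w i j * w k l = 0
  color : ∀ i j, X.color i ≠ X.color j → w i j = 0

theorem isQutMatrix_qutFund : X.IsQutMatrix X.qutFund := by
  have h0 : ∀ r, X.QutRel r → UniversalCStar.mk X.qutRelations X.isBounded_qutRelations r = 0 :=
    fun r hr => UniversalCStar.mk_eq_zero _ _ hr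
  refine ⟨⟨fun i j => ?_, fun i j => ?_, fun i => ?_, fun j => ?_⟩, fun i j k l h h' => ?_,
    fun i j k l h h' => ?_, fun i j h => ?_⟩
  · have h := h0 _ (QutRel.star_eq i j)
    rwa [map_sub, map_star, sub_eq_zero] at h
  · have h := h0 _ (QutRel.mul_self i j)
    rwa [map_sub, map_mul, sub_eq_zero] at h
  · have h := h0 _ (QutRel.sum_row i)
    rwa [map_sub, map_sum, map_one, sub_eq_zero] at h
  · have h := h0 _ (QutRel.sum_col j)
    rwa [map_sub, map_sum, map_one, sub_eq_zero] at h
  · have h := h0 _ (QutRel.adj_left i j k l h h')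
    rwa [map_mul] at h
  · have h := h0 _ (QutRel.adj_right i j k l h h')
    rwa [map_mul] at h
  · exact h0 _ (QutRel.color i j h)

/-- The universal property of `C(Qut_c(X))`. -/
noncomputable def qutLift {A : Type*} [CStarAlgebra A] (w : Matrix V V A) (hw : X.IsQutMatrix w) :
    X.QutAlgebra →⋆ₐ[ℂ] A :=
  UniversalCStar.lift _ _ (fun ij : V × V => w ij.1 ij.2) (by
    intro r hr
    change X.QutRel r at hr
    induction hr with
    | star_eq i j =>
      rw [map_sub, map_star, FreeStarAlgebra.lift_of, hw.magic.star_eq, sub_self]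
    | mul_self i j =>
      rw [map_sub, map_mul, FreeStarAlgebra.lift_of, hw.magic.mul_self, sub_self]
    | sum_row i =>
      simp_rw [map_sub, map_sum, FreeStarAlgebra.lift_of, hw.magic.sum_row, map_one, sub_self]
    | sum_col j =>
      simp_rw [map_sub, map_sum, FreeStarAlgebra.lift_of, hw.magic.sum_col, map_one, sub_self]
    | adj_left i j k l h h' =>
      rw [map_mul, FreeStarAlgebra.lift_of, FreeStarAlgebra.lift_of]
      exact hw.adj_left i j k l h h'
    | adj_right i j k l h h' =>
      rw [map_mul, FreeStarAlgebra.lift_of, FreeStarAlgebra.lift_of]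
      exact hw.adj_right i j k l h h'
    | color i j h =>
      rw [FreeStarAlgebra.lift_of]
      exact hw.color i j h)

theorem qutLift_fund {A : Type*} [CStarAlgebra A] (w : Matrix V V A) (hw : X.IsQutMatrix w)
    (i j : V) : X.qutLift w hw (X.qutFund i j) = w i j :=
  UniversalCStar.lift_gen _ _ _ _ _

/-- The matrix `∑ k, w i k ⊗ w k j` again satisfies the relations of `Qut_c(X)`. -/
theorem IsQutMatrix.comul [DecidableEq V] {A : Type u} [CStarAlgebra A] {w : Matrix V V A}
    (hw : X.IsQutMatrix w) :
    X.IsQutMatrix (Matrix.of fun i j => ∑ k, MinTensor.tmul (w i k) (w k j)) := by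
  have prod : ∀ i j k l, (∑ a, MinTensor.tmul (w i a) (w a j)) *
      (∑ b, MinTensor.tmul (w k b) (w b l)) =
      ∑ a, ∑ b, MinTensor.tmul (w i a * w k b) (w a j * w b l) := fun i j k l => by
    simp_rw [Finset.sum_mul_sum, MinTensor.tmul_mul_tmul]
  refine ⟨⟨fun i j => ?_, fun i j => ?_, fun i => ?_, fun j => ?_⟩, fun i j k l h h' => ?_,
    fun i j k l h h' => ?_, fun i j h => ?_⟩ <;> simp only [Matrix.of_apply]
  · simp_rw [star_sum, MinTensor.star_tmul, hw.magic.star_eq]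
  · rw [prod]
    refine Finset.sum_congr rfl (fun a _ => ?_)
    rw [Finset.sum_eq_single a, hw.magic.mul_self, hw.magic.mul_self]
    · intro b _ hb
      rw [hw.magic.row_orthogonal hb.symm, MinTensor.zero_tmul]
    · exact fun h => (h (Finset.mem_univ a)).elim
  · rw [Finset.sum_comm]
    simp_rw [← MinTensor.tmul_sum, hw.magic.sum_row, ← MinTensor.sum_tmul, hw.magic.sum_row,
      MinTensor.one_tmul_one]
  · rw [Finset.sum_comm]
    simp_rw [← MinTensor.sum_tmul, hw.magic.sum_col, ← MinTensor.tmul_sum, hw.magic.sum_col,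
      MinTensor.one_tmul_one]
  · rw [prod]
    refine Finset.sum_eq_zero (fun a _ => Finset.sum_eq_zero (fun b _ => ?_))
    by_cases hab : X.graph.Adj a b
    · rw [hw.adj_left a j b l hab h', MinTensor.tmul_zero]
    · rw [hw.adj_left i a k b h hab, MinTensor.zero_tmul]
  · rw [prod]
    refine Finset.sum_eq_zero (fun a _ => Finset.sum_eq_zero (fun b _ => ?_))
    by_cases hab : X.graph.Adj a b
    · rw [hw.adj_right i a k b h hab, MinTensor.zero_tmul]
    · rw [hw.adj_right a j b l hab h', MinTensor.tmul_zero]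
  · refine Finset.sum_eq_zero (fun a _ => ?_)
    by_cases ha : X.color i = X.color a
    · rw [hw.color a j (fun h' => h (ha.trans h')), MinTensor.tmul_zero]
    · rw [hw.color i a ha, MinTensor.zero_tmul]

/-- The quantum automorphism group `Qut_c(X)` of a finite colored graph. -/
noncomputable def qut [DecidableEq V] : CompactMatrixQuantumGroup V where
  Carrier := X.QutAlgebra
  fund := X.qutFund
  generates := UniversalCStar.topologicalClosure_adjoin_gen X.qutRelations X.isBounded_qutRelations
  isUnit_fund := X.isQutMatrix_qutFund.magic.isUnit
  isUnit_conj := by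
    rw [X.isQutMatrix_qutFund.magic.map_star_eq]
    exact X.isQutMatrix_qutFund.magic.isUnit
  comul := X.qutLift _ X.isQutMatrix_qutFund.comul
  comul_fund := X.qutLift_fund _ X.isQutMatrix_qutFund.comul

end Qut

end ColoredGraph

/-! ### Free products -/

namespace FreeProductCStar

variable {I : Type} (A : I → Type u) [∀ i, CStarAlgebra (A i)]

/-- The relations (`r = 0`) of the unital free product of the `A i`: its generators are the elements
of the `A i`, and all algebraic relations of each `A i` are imposed; the units are identified. -/
inductive Rel : FreeStarAlgebra (Σ i, A i) → Prop
  | add (i : I) (a b : A i) : Rel (FreeStarAlgebra.of ⟨i, a + b⟩ -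
      (FreeStarAlgebra.of ⟨i, a⟩ + FreeStarAlgebra.of ⟨i, b⟩))
  | mul (i : I) (a b : A i) : Rel (FreeStarAlgebra.of ⟨i, a * b⟩ -
      FreeStarAlgebra.of ⟨i, a⟩ * FreeStarAlgebra.of ⟨i, b⟩)
  | star (i : I) (a : A i) : Rel (FreeStarAlgebra.of ⟨i, star a⟩ - star (FreeStarAlgebra.of ⟨i, a⟩))
  | scalar (i : I) (c : ℂ) : Rel (FreeStarAlgebra.of ⟨i, algebraMap ℂ (A i) c⟩ - algebraMap ℂ _ c)

/-- The set of relations of the free product. -/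
def relations : Set (FreeStarAlgebra (Σ i, A i)) := {r | Rel A r}

variable {A} in
/-- A *-homomorphism of the free *-algebra killing the relations gives *-homomorphisms on the
factors. -/
noncomputable def factorHom {B : Type*} [CStarAlgebra B] (f : FreeStarAlgebra (Σ i, A i) →⋆ₐ[ℂ] B)
    (hf : ∀ r, Rel A r → f r = 0) (i : I) : A i →⋆ₐ[ℂ] B where
  toFun a := f (FreeStarAlgebra.of ⟨i, a⟩)
  map_one' := by
    have h := hf _ (Rel.scalar i 1)
    rwa [map_sub, map_one, map_one, map_one, sub_eq_zero] at h
  map_zero' := by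
    have h := hf _ (Rel.scalar i 0)
    rwa [map_sub, map_zero, map_zero, map_zero, sub_zero] at h
  map_add' a b := by
    have h := hf _ (Rel.add i a b)
    rwa [map_sub, map_add, sub_eq_zero] at h
  map_mul' a b := by
    have h := hf _ (Rel.mul i a b)
    rwa [map_sub, map_mul, sub_eq_zero] at h
  commutes' c := by
    have h := hf _ (Rel.scalar i c)
    rwa [map_sub, AlgHomClass.commutes, sub_eq_zero] at h
  map_star' a := by
    have h := hf _ (Rel.star i a)
    rwa [map_sub, map_star, sub_eq_zero] at h

theorem isBounded_relations : UniversalCStar.IsBounded (relations A) := by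
  rintro ⟨i, a⟩
  refine ⟨‖a‖, ?_⟩
  rintro _ ⟨p, hp, rfl⟩
  have h0 : ∀ r, Rel A r → p.coe r = 0 := fun r hr => by
    rw [← norm_eq_zero, p.norm_coe_apply]; exact hp r hr
  change p _ ≤ _
  rw [← p.norm_coe_apply]
  exact NonUnitalStarAlgHom.norm_apply_le (factorHom p.coe h0 i) a

end FreeProductCStar

/-- The unital free product of a family of unital C*-algebras. -/
abbrev FreeProductCStar {I : Type} (A : I → Type u) [∀ i, CStarAlgebra (A i)] : Type u :=
  UniversalCStar (FreeProductCStar.relations A) (FreeProductCStar.isBounded_relations A)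

namespace FreeProductCStar

variable {I : Type} {A : I → Type u} [∀ i, CStarAlgebra (A i)]

/-- The canonical *-homomorphism of a factor into the free product. -/
noncomputable def incl (i : I) : A i →⋆ₐ[ℂ] FreeProductCStar A :=
  factorHom (UniversalCStar.mk (relations A) (isBounded_relations A))
    (fun _ hr => UniversalCStar.mk_eq_zero _ _ hr) i

/-- The universal property of the free product. -/
noncomputable def lift {B : Type*} [CStarAlgebra B] (f : ∀ i, A i →⋆ₐ[ℂ] B) :
    FreeProductCStar A →⋆ₐ[ℂ] B :=
  UniversalCStar.lift _ _ (fun x : Σ i, A i => f x.1 x.2) (by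
    intro r hr
    change Rel A r at hr
    induction hr with
    | add i a b => simp_rw [map_sub, map_add, FreeStarAlgebra.lift_of, map_add, sub_self]
    | mul i a b => simp_rw [map_sub, map_mul, FreeStarAlgebra.lift_of, map_mul, sub_self]
    | star i a => simp_rw [map_sub, map_star, FreeStarAlgebra.lift_of, map_star, sub_self]
    | scalar i c =>
      simp_rw [map_sub, FreeStarAlgebra.lift_of, AlgHomClass.commutes, sub_self])

theorem lift_incl {B : Type*} [CStarAlgebra B] (f : ∀ i, A i →⋆ₐ[ℂ] B) (i : I) (a : A i) :
    lift f (incl i a) = f i a :=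
  UniversalCStar.lift_gen _ _ (fun x : Σ i, A i => f x.1 x.2) _ ⟨i, a⟩

end FreeProductCStar

namespace CompactMatrixQuantumGroup

theorem isUnit_map_matrix {κ A B : Type*} [Fintype κ] [DecidableEq κ] [CStarAlgebra A]
    [CStarAlgebra B] (f : A →⋆ₐ[ℂ] B) {M : Matrix κ κ A} (hM : IsUnit M) : IsUnit (M.map f) :=
  hM.map (RingHom.mapMatrix (f : A →+* B))

variable {I : Type} [DecidableEq I] {ι : I → Type u} [∀ i, Fintype (ι i)]
  [∀ i, DecidableEq (ι i)] (G : ∀ i, CompactMatrixQuantumGroup (ι i))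

/-- The canonical *-homomorphism of `C(G i)` into the free product of the C*-algebras `C(G i)`. -/
noncomputable def freeProductIncl (i : I) :
    (G i).Carrier →⋆ₐ[ℂ] FreeProductCStar fun i => (G i).Carrier :=
  FreeProductCStar.incl (A := fun i => (G i).Carrier) i

/-- The images of the fundamental representations in the free product. -/
noncomputable def freeProductBlock (i : I) :
    Matrix (ι i) (ι i) (FreeProductCStar fun i => (G i).Carrier) :=
  (G i).fund.map (freeProductIncl G i)

/-- The block diagonal matrix `⊕ i, u⁽ⁱ⁾` over the free product. -/
noncomputable def freeProductFund :
    Matrix (Σ i, ι i) (Σ i, ι i) (FreeProductCStar fun i => (G i).Carrier) :=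
  Matrix.blockDiagonal' (freeProductBlock G)

/-- The comultiplication of the free product. -/
noncomputable def freeProductComul : (FreeProductCStar fun i => (G i).Carrier) →⋆ₐ[ℂ]
    MinTensor (FreeProductCStar fun i => (G i).Carrier) (FreeProductCStar fun i => (G i).Carrier) :=
  FreeProductCStar.lift fun i =>
    (MinTensor.map (freeProductIncl G i) (freeProductIncl G i)).comp (G i).comul

theorem freeProduct_generates : (StarAlgebra.adjoin ℂ (Set.range
    fun x : (Σ i, ι i) × (Σ i, ι i) => freeProductFund G x.1 x.2)).topologicalClosure = ⊤ := by
  set T := (StarAlgebra.adjoin ℂ (Set.range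
    fun x : (Σ i, ι i) × (Σ i, ι i) => freeProductFund G x.1 x.2)).topologicalClosure with hT
  have hcont : ∀ i, Continuous (freeProductIncl G i) := fun i =>
    (AddMonoidHomClass.lipschitz_of_bound _ 1 (fun a => by
      rw [one_mul]; exact NonUnitalStarAlgHom.norm_apply_le _ a)).continuous
  have key : ∀ i (a : (G i).Carrier),
      freeProductIncl G i a ∈ T := by
    intro i a
    have h1 : (StarAlgebra.adjoin ℂ (Set.range fun ij : ι i × ι i => (G i).fund ij.1 ij.2)) ≤
        T.comap (freeProductIncl G i) := by
      rw [StarAlgebra.adjoin_le_iff]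
      rintro _ ⟨⟨k, l⟩, rfl⟩
      change freeProductIncl G i ((G i).fund k l) ∈ T
      apply StarSubalgebra.le_topologicalClosure
      apply StarAlgebra.subset_adjoin
      exact ⟨(⟨i, k⟩, ⟨i, l⟩), Matrix.blockDiagonal'_apply_eq (freeProductBlock G) i k l⟩
    have h2 : IsClosed ((T.comap (freeProductIncl G i) :
        StarSubalgebra ℂ (G i).Carrier) : Set (G i).Carrier) :=
      (StarSubalgebra.isClosed_topologicalClosure _).preimage (hcont i)
    have h3 := StarSubalgebra.topologicalClosure_minimal h1 h2
    rw [(G i).generates] at h3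
    exact h3 (StarSubalgebra.mem_top (x := a))
  have h4 := UniversalCStar.topologicalClosure_adjoin_gen
    (FreeProductCStar.relations fun i => (G i).Carrier) (FreeProductCStar.isBounded_relations _)
  rw [eq_top_iff, ← h4]
  apply StarSubalgebra.topologicalClosure_minimal _ (StarSubalgebra.isClosed_topologicalClosure _)
  rw [StarAlgebra.adjoin_le_iff]
  rintro _ ⟨⟨i, a⟩, rfl⟩
  exact key i a

/-- The free product of compact matrix quantum groups: the free product of the C*-algebras with the
direct sum of the fundamental representations. -/
noncomputable def freeProduct [Fintype I] : CompactMatrixQuantumGroup (Σ i, ι i) where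
  Carrier := FreeProductCStar fun i => (G i).Carrier
  fund := freeProductFund G
  generates := freeProduct_generates G
  isUnit_fund := by
    have h : ∀ i, IsUnit (freeProductBlock G i) := fun i =>
      isUnit_map_matrix (freeProductIncl G i) (G i).isUnit_fund
    exact (Pi.isUnit_iff.2 h).map (Matrix.blockDiagonal'RingHom ι _)
  isUnit_conj := by
    have h : ∀ i, IsUnit ((freeProductBlock G i).map star) := fun i => by
      have h1 : (freeProductBlock G i).map star =
          ((G i).fund.map star).map (freeProductIncl G i) := by
        ext k l
        exact (map_star (freeProductIncl G i) ((G i).fund k l)).symm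
      rw [h1]
      exact isUnit_map_matrix (freeProductIncl G i) (G i).isUnit_conj
    rw [freeProductFund, Matrix.blockDiagonal'_map _ _ (star_zero _)]
    exact (Pi.isUnit_iff.2 h).map (Matrix.blockDiagonal'RingHom ι _)
  comul := freeProductComul G
  comul_fund := by
    rintro ⟨i, k⟩ ⟨j, l⟩
    rw [Fintype.sum_sigma]
    by_cases hij : i = j
    · subst hij
      rw [Finset.sum_eq_single i]
      · simp only [freeProductFund, Matrix.blockDiagonal'_apply_eq, freeProductBlock,
          Matrix.map_apply]
        rw [freeProductComul, freeProductIncl, FreeProductCStar.lift_incl, StarAlgHom.comp_apply,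
          (G i).comul_fund, map_sum]
        simp_rw [MinTensor.map_tmul]
        rfl
      · intro m _ hm
        refine Finset.sum_eq_zero (fun a _ => ?_)
        rw [freeProductFund, Matrix.blockDiagonal'_apply_ne _ _ _ hm.symm, MinTensor.zero_tmul]
      · exact fun h => (h (Finset.mem_univ i)).elim
    · rw [freeProductFund, Matrix.blockDiagonal'_apply_ne _ _ _ hij, map_zero]
      symm
      refine Finset.sum_eq_zero (fun m _ => Finset.sum_eq_zero (fun a _ => ?_))
      by_cases him : i = m
      · subst him
        rw [Matrix.blockDiagonal'_apply_ne _ a l hij, MinTensor.tmul_zero]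
      · rw [Matrix.blockDiagonal'_apply_ne _ k a him, MinTensor.zero_tmul]

end CompactMatrixQuantumGroup

/-! Everything rests on one fact: a magic unitary `w` satisfying the relations of the disjoint union
has zero entries between different summands. Once this is known, the fundamental representation of
the disjoint union is block diagonal, and the two universal properties give mutually inverse
*-homomorphisms.

The vanishing comes from connectedness. Let `K` and `L` be connected components of the union. For
`x` in `K` let `p_x` be the sum of the entries `w x y` with `y` in `L`. If `x` and `x'` are
adjacent, no vertex of `L` is adjacent to a vertex outside `L`, so `p_x * (1 - p_x') = 0` and `(1 -
p_x) * p_x' = 0`; hence `p_x = p_x'` (`IsQutMatrix.sum_eq_of_adj`), and `p_x` is one projection `p`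
for all of `K` (`IsQutMatrix.sum_eq_of_connected`). By transposition the column sums over `K` are
one projection `q`. Adding up the block in both orders gives `|K| p = |L| q`, and idempotence forces
`p = q` (`eq_of_natCast_smul_eq`).

The block `K × L` is therefore a magic unitary over the corner `p A p`, whose unit is `p`. It
respects the colors, and it intertwines the adjacency matrices because `w` does
(`IsQutMatrix.sum_adj`). A nonzero entry in the block makes `p` nonzero, so that `K` and `L` are
quantum isomorphic (`IsQutMatrix.quantumIsomorphic`). For components of different summands this is
excluded by hypothesis.

Conversely, a block-diagonal matrix with blocks satisfying the relations of the summands satisfies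
those of the union, with no hypothesis on components (`isQutMatrix_blockDiagonal'`). All
homomorphisms are determined by the fundamental representation, which settles both invertibility and
the comultiplications (`same_of_starAlgHom`). -/

/-! ### Corners of C*-algebras -/

/-- The corner `p A p` of a C*-algebra at a projection `p`, as a non-unital star subalgebra. -/
def cornerSubalgebra {A : Type*} [CStarAlgebra A] {p : A} (hp : IsStarProjection p) :
    NonUnitalStarSubalgebra ℂ A where
  carrier := {a | p * a = a ∧ a * p = a}
  add_mem' := fun ⟨h1, h2⟩ ⟨h3, h4⟩ => ⟨by rw [mul_add, h1, h3], by rw [add_mul, h2, h4]⟩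
  zero_mem' := ⟨mul_zero _, zero_mul _⟩
  mul_mem' := fun ⟨h1, _⟩ ⟨_, h4⟩ => ⟨by rw [← mul_assoc, h1], by rw [mul_assoc, h4]⟩
  smul_mem' := fun c _ ⟨h1, h2⟩ => ⟨by rw [mul_smul_comm, h1], by rw [smul_mul_assoc, h2]⟩
  star_mem' := fun {a} ⟨h1, h2⟩ => by
    have hs : star p = p := hp.isSelfAdjoint
    exact ⟨by simpa [hs] using congrArg star h2, by simpa [hs] using congrArg star h1⟩

/-- The corner `p A p` of a C*-algebra at a projection `p`, a C*-algebra with unit `p`. -/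
def CStarCorner {A : Type*} [CStarAlgebra A] {p : A} (hp : IsStarProjection p) : Type _ :=
  cornerSubalgebra hp

namespace CStarCorner

variable {A : Type*} [CStarAlgebra A] {p : A} (hp : IsStarProjection p)

noncomputable instance : NonUnitalNormedRing (CStarCorner hp) :=
  inferInstanceAs (NonUnitalNormedRing (cornerSubalgebra hp))
noncomputable instance : StarRing (CStarCorner hp) :=
  inferInstanceAs (StarRing (cornerSubalgebra hp))
noncomputable instance : NormedSpace ℂ (CStarCorner hp) :=
  inferInstanceAs (NormedSpace ℂ (cornerSubalgebra hp))
instance : IsScalarTower ℂ (CStarCorner hp) (CStarCorner hp) :=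
  inferInstanceAs (IsScalarTower ℂ (cornerSubalgebra hp) (cornerSubalgebra hp))
instance : SMulCommClass ℂ (CStarCorner hp) (CStarCorner hp) :=
  inferInstanceAs (SMulCommClass ℂ (cornerSubalgebra hp) (cornerSubalgebra hp))
instance : StarModule ℂ (CStarCorner hp) :=
  inferInstanceAs (StarModule ℂ (cornerSubalgebra hp))
instance : CStarRing (CStarCorner hp) where
  norm_mul_self_le a := CStarRing.norm_mul_self_le a.1

theorem isClosed_cornerSubalgebra : IsClosed (cornerSubalgebra hp : Set A) :=
  (isClosed_eq (by fun_prop) continuous_id).inter (isClosed_eq (by fun_prop) continuous_id)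

instance : CompleteSpace (CStarCorner hp) :=
  (isClosed_cornerSubalgebra hp).completeSpace_coe

noncomputable instance : NormedRing (CStarCorner hp) where
  __ := (inferInstance : NonUnitalNormedRing (CStarCorner hp))
  -- The unit is `p` and not the unit of `A`. This is why only the non-unital structure can be
  -- inherited from `A`.
  one := ⟨p, hp.isIdempotentElem, hp.isIdempotentElem⟩
  one_mul a := Subtype.ext a.2.1
  mul_one a := Subtype.ext a.2.2

noncomputable instance : Algebra ℂ (CStarCorner hp) :=
  Algebra.ofModule smul_mul_assoc mul_smul_comm

noncomputable instance : NormedAlgebra ℂ (CStarCorner hp) where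
  norm_smul_le := norm_smul_le

noncomputable instance : CStarAlgebra (CStarCorner hp) where

/-- The inclusion of the corner, as an additive homomorphism. -/
def val : CStarCorner hp →+ A where
  toFun a := a.1
  map_zero' := rfl
  map_add' _ _ := rfl

/-- An element fixed by multiplication with `p` as an element of the corner. -/
def ofFixed (a : A) (h1 : p * a = a) (h2 : a * p = a) : CStarCorner hp := ⟨a, h1, h2⟩

theorem val_injective : Function.Injective (val hp) := Subtype.val_injective

theorem val_one : val hp 1 = p := rfl

theorem nontrivial (h : p ≠ 0) : Nontrivial (CStarCorner hp) :=
  ⟨1, 0, fun h' => h (by rw [← val_one hp, h', map_zero])⟩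

end CStarCorner

-- Turns a sum over neighbors inside a component into a sum over neighbors in the whole graph. In
-- that use `hQ` says that the component is closed under adjacency, so no neighbor is lost.
open Classical in
theorem Finset.sum_filter_embedding {V W M : Type*} [Fintype V] [Fintype W] [AddCommMonoid M]
    (e : V ↪ W) {P : V → Prop} {Q : W → Prop} (h : ∀ x, Q (e x) ↔ P x)
    (hQ : ∀ v, Q v → v ∈ Set.range e) (F : W → M) :
    ∑ x with P x, F (e x) = ∑ v with Q v, F v := by
  rw [← Finset.sum_map _ e F]
  refine Finset.sum_congr ?_ fun _ _ => rfl
  ext v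
  simp only [Finset.mem_map, Finset.mem_filter, Finset.mem_univ, true_and]
  constructor
  · rintro ⟨x, hx, rfl⟩
    exact (h x).2 hx
  · intro hv
    obtain ⟨x, rfl⟩ := hQ v hv
    exact ⟨x, (h x).1 hv, rfl⟩

/-! ### Matrices satisfying the relations of a quantum automorphism group -/

namespace ColoredGraph

namespace IsQutMatrix

variable {V C A : Type*} [Fintype V] [CStarAlgebra A] {X : ColoredGraph V C}
  {w : Matrix V V A}

-- This is the entrywise form of `A_X w = w A_X`. Both sides equal the sum of `w x y' * w x' y` over
-- all pairs with `x ~ x'` and `y' ~ y`: on the left, insert the sum of row `x` in front of `w x'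
-- y`; on the right, insert the sum of column `y` behind `w x y'`. The adjacency relations kill all
-- other terms.
open Classical in
theorem sum_adj (hw : X.IsQutMatrix w) (x y : V) :
    ∑ x' with X.graph.Adj x x', w x' y = ∑ y' with X.graph.Adj y' y, w x y' := by
  have h1 : ∀ x', w x' y * (if X.graph.Adj x x' then 1 else 0) =
      ∑ y', if X.graph.Adj y' y ∧ X.graph.Adj x x' then w x y' * w x' y else 0 := by
    intro x'
    split_ifs with h
    · rw [mul_one]
      nth_rw 1 [← one_mul (w x' y)]
      rw [← hw.magic.sum_row x, Finset.sum_mul]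
      refine Finset.sum_congr rfl fun y' _ => ?_
      split_ifs with h'
      · rfl
      · exact hw.adj_left _ _ _ _ h fun h'' => h' ⟨h'', h⟩
    · simp [h]
  have h2 : ∀ y', w x y' * (if X.graph.Adj y' y then 1 else 0) =
      ∑ x', if X.graph.Adj y' y ∧ X.graph.Adj x x' then w x y' * w x' y else 0 := by
    intro y'
    split_ifs with h
    · rw [mul_one]
      nth_rw 1 [← mul_one (w x y')]
      rw [← hw.magic.sum_col y, Finset.mul_sum]
      refine Finset.sum_congr rfl fun x' _ => ?_
      split_ifs with h'
      · rfl
      · exact hw.adj_right _ _ _ _ (fun h'' => h' ⟨h, h''⟩) h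
    · simp [h]
  rw [Finset.sum_filter, Finset.sum_filter]
  simp_rw [mul_ite, mul_one, mul_zero] at h1 h2
  rw [Finset.sum_congr rfl fun x' _ => h1 x', Finset.sum_congr rfl fun y' _ => h2 y',
    Finset.sum_comm]

/-- Transposition exchanges the two adjacency relations, so every statement about partial row sums
also yields one about partial column sums. -/
theorem transpose (hw : X.IsQutMatrix w) : X.IsQutMatrix w.transpose where
  magic := ⟨fun i j => hw.magic.star_eq j i, fun i j => hw.magic.mul_self j i,
    hw.magic.sum_col, hw.magic.sum_row⟩
  adj_left i j k l h h' := hw.adj_right j i l k h' h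
  adj_right i j k l h h' := hw.adj_left j i l k h' h
  color i j h := hw.color j i h.symm

section Embedding

variable {V₂ : Type*} [Fintype V₂]

/-- Distinct entries of a row are orthogonal, so only the diagonal term survives. Together with
`entry_mul_sum` this places the entry in the corner cut out by the partial row sum. -/
theorem sum_mul_entry (hw : X.IsQutMatrix w) (g : V₂ ↪ V) (x : V) (y : V₂) :
    (∑ y', w x (g y')) * w x (g y) = w x (g y) := by
  rw [Finset.sum_mul, Finset.sum_eq_single y, hw.magic.mul_self]
  · exact fun b _ hb => hw.magic.row_orthogonal (g.injective.ne hb)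
  · exact fun h => (h (Finset.mem_univ y)).elim

theorem entry_mul_sum (hw : X.IsQutMatrix w) (g : V₂ ↪ V) (x : V) (y : V₂) :
    w x (g y) * (∑ y', w x (g y')) = w x (g y) := by
  rw [Finset.mul_sum, Finset.sum_eq_single y, hw.magic.mul_self]
  · exact fun b _ hb => hw.magic.row_orthogonal (g.injective.ne hb.symm)
  · exact fun h => (h (Finset.mem_univ y)).elim

theorem isStarProjection_sum (hw : X.IsQutMatrix w) (g : V₂ ↪ V) (x : V) :
    IsStarProjection (∑ y, w x (g y)) := by
  refine ⟨?_, ?_⟩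
  · rw [IsIdempotentElem, Finset.mul_sum]
    exact Finset.sum_congr rfl fun y _ => hw.sum_mul_entry g x y
  · rw [IsSelfAdjoint, star_sum]
    exact Finset.sum_congr rfl fun y _ => hw.magic.star_eq _ _

/-- If the range of `g` is closed under adjacency, then the sum of the entries of a row over the
range of `g` agrees for adjacent rows. -/
theorem sum_eq_of_adj (hw : X.IsQutMatrix w) (g : V₂ ↪ V)
    (hg : ∀ y v, X.graph.Adj (g y) v → v ∈ Set.range g) {x x' : V} (h : X.graph.Adj x x') :
    ∑ y, w x (g y) = ∑ y, w x' (g y) := by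
  classical
  -- The entries of row `z` outside the range of `g` add up to the complementary projection `1 -
  -- p_z`, where `p_z` is the sum over the range.
  have key : ∀ z, (∑ y, w z (g y)) + ∑ v with v ∉ Set.range g, w z v = 1 := by
    intro z
    rw [← hw.magic.sum_row z, ← Finset.sum_filter_add_sum_filter_not Finset.univ (· ∈ Set.range g)]
    congr 1
    simpa using Finset.sum_filter_embedding g (P := fun _ => True)
      (Q := (· ∈ Set.range g)) (by simp) (fun _ hv => hv) (fun v => w z v)
  -- The rows `x` and `x'` are adjacent, while a vertex in the range is never adjacent to one
  -- outside it, so every product vanishes.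
  have h0 : (∑ y, w x (g y)) * (∑ v with v ∉ Set.range g, w x' v) = 0 := by
    rw [Finset.sum_mul_sum]
    refine Finset.sum_eq_zero fun y _ => Finset.sum_eq_zero fun v hv => ?_
    exact hw.adj_left _ _ _ _ h fun h' => (Finset.mem_filter.1 hv).2 (hg y v h')
  have h1 : (∑ v with v ∉ Set.range g, w x v) * (∑ y, w x' (g y)) = 0 := by
    rw [Finset.sum_mul_sum]
    refine Finset.sum_eq_zero fun v hv => Finset.sum_eq_zero fun y _ => ?_
    exact hw.adj_left _ _ _ _ h fun h' => (Finset.mem_filter.1 hv).2 (hg y v h'.symm)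
  -- The two orthogonality relations become `p_x = p_x * p_x'` and `p_x' = p_x * p_x'`.
  rw [← sub_eq_iff_eq_add'.2 (key x').symm, mul_sub, mul_one, sub_eq_zero] at h0
  rw [← sub_eq_iff_eq_add'.2 (key x).symm, sub_mul, one_mul, sub_eq_zero] at h1
  exact h0.trans h1.symm

/-- Follow a walk and apply `sum_eq_of_adj` at each edge. The rows need only a homomorphism; closure
under adjacency matters on the column side alone. -/
theorem sum_eq_of_connected {V₁ : Type*} {Y₁ : SimpleGraph V₁} (hw : X.IsQutMatrix w)
    (f : Y₁ →g X.graph) (hY : Y₁.Preconnected) (g : V₂ ↪ V)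
    (hg : ∀ y v, X.graph.Adj (g y) v → v ∈ Set.range g) (x x' : V₁) :
    ∑ y, w (f x) (g y) = ∑ y, w (f x') (g y) := by
  obtain ⟨p⟩ := hY x x'
  induction p with
  | nil => rfl
  | cons h _ ih => exact (hw.sum_eq_of_adj g hg (f.map_adj h)).trans ih

end Embedding

end IsQutMatrix

/-! ### From a nonvanishing block to a quantum isomorphism -/

/-- Write `p = c • q` with `c = n / m ≠ 0`. Idempotence of both gives `c² • q = c • q`, and
cancelling one factor `c` leaves `c • q = q`. The case `q = 0` needs no separate treatment, and `m =
n` is not claimed. -/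
theorem eq_of_natCast_smul_eq {A : Type*} [Ring A] [Algebra ℂ A] {p q : A}
    (hp : IsIdempotentElem p) (hq : IsIdempotentElem q) {m n : ℕ} (hm : m ≠ 0) (hn : n ≠ 0)
    (h : m • p = n • q) : p = q := by
  have hm' : (m : ℂ) ≠ 0 := Nat.cast_ne_zero.2 hm
  have hn' : (n : ℂ) ≠ 0 := Nat.cast_ne_zero.2 hn
  rw [← Nat.cast_smul_eq_nsmul ℂ, ← Nat.cast_smul_eq_nsmul ℂ] at h
  set c : ℂ := (m : ℂ)⁻¹ * n with hc
  have hc0 : c ≠ 0 := mul_ne_zero (inv_ne_zero hm') hn'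
  have h1 : p = c • q := by rw [hc, mul_smul, ← h, smul_smul, inv_mul_cancel₀ hm', one_smul]
  have h2 : (c * c) • q = c • q := by
    have := hp.eq
    rwa [h1, smul_mul_smul_comm, hq.eq] at this
  have h3 : c • q = q := by
    rw [mul_smul] at h2
    exact (smul_right_injective A hc0) h2
  rw [h1, h3]

open Classical in
theorem adjMatrix_mul_comm_of_sum_eq {V W R : Type*} [Fintype V] [Fintype W] [NonAssocSemiring R]
    {G : SimpleGraph V} {H : SimpleGraph W} {M : Matrix V W R}
    (h : ∀ x y, ∑ x' with G.Adj x x', M x' y = ∑ y' with H.Adj y' y, M x y') :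
    G.adjMatrix R * M = M * H.adjMatrix R := by
  ext x y
  simpa [Matrix.mul_apply, SimpleGraph.adjMatrix_apply, Finset.sum_filter] using h x y

/-- Connected graphs embedded as unions of connected components into a colored graph are quantum
isomorphic if the corresponding block of a matrix satisfying the relations of the quantum
automorphism group does not vanish. -/
theorem IsQutMatrix.quantumIsomorphic {V C : Type*} [Fintype V] {A : Type u}
    [CStarAlgebra A] {V₁ V₂ : Type u} [Fintype V₁] [Fintype V₂] {X : ColoredGraph V C}
    {w : Matrix V V A} (hw : X.IsQutMatrix w) {Y₁ : ColoredGraph V₁ C} {Y₂ : ColoredGraph V₂ C}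
    (hY₁ : Y₁.graph.Preconnected) (hY₂ : Y₂.graph.Preconnected)
    (f : Y₁.graph ↪g X.graph) (g : Y₂.graph ↪g X.graph)
    (hf : ∀ x v, X.graph.Adj (f x) v → v ∈ Set.range f)
    (hg : ∀ y v, X.graph.Adj (g y) v → v ∈ Set.range g)
    (hfc : ∀ x, X.color (f x) = Y₁.color x) (hgc : ∀ y, X.color (g y) = Y₂.color y)
    {x₀ : V₁} {y₀ : V₂} (h : w (f x₀) (g y₀) ≠ 0) : Y₁.QuantumIsomorphic Y₂ := by
  classical
  set p : A := ∑ y, w (f x₀) (g y) with hp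
  have hrow : ∀ x, ∑ y, w (f x) (g y) = p := fun x =>
    hw.sum_eq_of_connected f.toHom hY₁ g.toEmbedding hg x x₀
  -- For the transposed matrix the roles of the two graphs are exchanged, so here `hY₂` and `hf` are
  -- what is needed.
  have hcol' : ∀ y, ∑ x, w (f x) (g y) = ∑ x, w (f x) (g y₀) := fun y =>
    hw.transpose.sum_eq_of_connected g.toHom hY₂ f.toEmbedding hf y y₀
  have hpp : IsStarProjection p := hw.isStarProjection_sum g.toEmbedding (f x₀)
  have hqq : IsStarProjection (∑ x, w (f x) (g y₀)) :=
    hw.transpose.isStarProjection_sum f.toEmbedding (g y₀)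
  -- Count the block twice: by rows it sums to `|V₁| • p`, by columns to `|V₂|` times the common
  -- column sum. Both cardinalities are nonzero because of `x₀` and `y₀`.
  have hpq : p = ∑ x, w (f x) (g y₀) := by
    have : Nonempty V₁ := ⟨x₀⟩
    have : Nonempty V₂ := ⟨y₀⟩
    refine eq_of_natCast_smul_eq hpp.isIdempotentElem hqq.isIdempotentElem
      (Fintype.card_ne_zero (α := V₁)) (Fintype.card_ne_zero (α := V₂)) ?_
    calc Fintype.card V₁ • p = ∑ x, ∑ y, w (f x) (g y) := by simp [hrow]
      _ = ∑ y, ∑ x, w (f x) (g y) := Finset.sum_comm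
      _ = _ := by simp [hcol']
  have hcol : ∀ y, ∑ x, w (f x) (g y) = p := fun y => (hcol' y).trans hpq.symm
  have hl : ∀ x y, p * w (f x) (g y) = w (f x) (g y) := fun x y => by
    rw [← hrow x]; exact hw.sum_mul_entry g.toEmbedding (f x) y
  have hr : ∀ x y, w (f x) (g y) * p = w (f x) (g y) := fun x y => by
    rw [← hrow x]; exact hw.entry_mul_sum g.toEmbedding (f x) y
  -- Only here does the nonzero entry enter: it makes the corner a nonzero algebra.
  have hp0 : p ≠ 0 := fun h0 => h (by rw [← hl, h0, zero_mul])
  -- The rows and columns of the block sum to `p` instead of `1`, so the block becomes a magic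
  -- unitary over the corner `p A p`.
  refine ⟨CStarCorner hpp, inferInstance, CStarCorner.nontrivial hpp hp0,
    Matrix.of fun x y => CStarCorner.ofFixed hpp (w (f x) (g y)) (hl x y) (hr x y),
    ⟨fun x y => ?_, fun x y => ?_, fun x => ?_, fun y => ?_⟩, ?_, fun x y hxy => ?_⟩
  · exact CStarCorner.val_injective hpp (hw.magic.star_eq _ _)
  · exact CStarCorner.val_injective hpp (hw.magic.mul_self _ _)
  · apply CStarCorner.val_injective hpp
    rw [map_sum, CStarCorner.val_one]
    exact hrow x
  · apply CStarCorner.val_injective hpp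
    rw [map_sum, CStarCorner.val_one]
    exact hcol y
  · refine adjMatrix_mul_comm_of_sum_eq fun x y => ?_
    apply CStarCorner.val_injective hpp
    rw [map_sum, map_sum]
    -- Neighbor sums within the first graph are neighbor sums in `X`; `sum_adj` moves them from rows
    -- to columns, and the second reindexing returns to the second graph.
    exact (Finset.sum_filter_embedding f.toEmbedding (fun _ => f.map_adj_iff) (hf x)
      fun v => w v (g y)).trans ((hw.sum_adj (f x) (g y)).trans
      (Finset.sum_filter_embedding g.toEmbedding (P := fun y' => Y₂.graph.Adj y' y)
        (Q := fun v => X.graph.Adj v (g y)) (fun _ => g.map_adj_iff)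
        (fun v hv => hg y v hv.symm) fun v => w (f x) v).symm)
  · apply CStarCorner.val_injective hpp
    exact hw.color _ _ (by rwa [hfc, hgc])

end ColoredGraph

namespace ColoredGraph

/-! ### Disjoint unions -/

section DisjointUnion

variable {I C : Type*} {V : I → Type*} (X : ∀ i, ColoredGraph (V i) C)

theorem disjointUnion_adj_iff {i : I} {a b : V i} :
    (disjointUnion X).graph.Adj ⟨i, a⟩ ⟨i, b⟩ ↔ (X i).graph.Adj a b := by
  constructor
  · rintro ⟨j, a', b', h, ha, hb⟩
    cases ha
    cases hb
    exact h
  · exact fun h => ⟨i, a, b, h, rfl, rfl⟩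

theorem fst_eq_of_disjointUnion_adj {x y : Σ i, V i} (h : (disjointUnion X).graph.Adj x y) :
    x.1 = y.1 := by
  obtain ⟨i, a, b, -, rfl, rfl⟩ := h
  rfl

/-- A connected component of a member of a family of graphs, embedded into the disjoint union. -/
def componentEmbedding (i : I) (K : (X i).graph.ConnectedComponent) :
    ((X i).component K).graph ↪g (disjointUnion X).graph where
  toFun x := ⟨i, x⟩
  inj' _ _ h := Subtype.ext (eq_of_heq (Sigma.mk.inj h).2)
  map_rel_iff' := disjointUnion_adj_iff X

/-- An edge of the disjoint union stays inside one summand, and there it stays inside one component.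
This supplies the closure hypotheses of `IsQutMatrix.quantumIsomorphic`. -/
theorem mem_range_componentEmbedding {i : I} {K : (X i).graph.ConnectedComponent} (x : K)
    {v : Σ i, V i} (h : (disjointUnion X).graph.Adj (componentEmbedding X i K x) v) :
    v ∈ Set.range (componentEmbedding X i K) := by
  obtain ⟨j, b⟩ := v
  obtain rfl : i = j := fst_eq_of_disjointUnion_adj X h
  have hb : (X i).graph.Adj x b := (disjointUnion_adj_iff X).1 h
  exact ⟨⟨b, K.mem_supp_of_adj_mem_supp x.2 hb⟩, rfl⟩

end DisjointUnion

/-! ### Block structure of magic unitaries on a disjoint union -/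

section Blocks

variable {I : Type} {C : Type*} [Fintype I] {V : I → Type u} [∀ i, Fintype (V i)]
  {X : ∀ i, ColoredGraph (V i) C}

/-- A nonzero entry would make the components of `x` and `y` quantum isomorphic. The algebra lives
in the universe `u` since the corner witnessing this must be admissible in `QuantumIsomorphic`. -/
theorem IsQutMatrix.entry_eq_zero {A : Type u} [CStarAlgebra A]
    {w : Matrix (Σ i, V i) (Σ i, V i) A} (hw : (disjointUnion X).IsQutMatrix w)
    (hX : ∀ i j, i ≠ j → ∀ (K : (X i).graph.ConnectedComponent)
      (L : (X j).graph.ConnectedComponent),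
      ¬ ((X i).component K).QuantumIsomorphic ((X j).component L))
    {i j : I} (hij : i ≠ j) (x : V i) (y : V j) : w ⟨i, x⟩ ⟨j, y⟩ = 0 := by
  by_contra h
  let K := (X i).graph.connectedComponentMk x
  let L := (X j).graph.connectedComponentMk y
  exact hX i j hij K L (hw.quantumIsomorphic (Y₁ := (X i).component K) (Y₂ := (X j).component L)
    K.connected_toSimpleGraph.preconnected L.connected_toSimpleGraph.preconnected
    (componentEmbedding X i K) (componentEmbedding X j L)
    (fun x _ => mem_range_componentEmbedding X x) (fun y _ => mem_range_componentEmbedding X y)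
    (fun _ => rfl) (fun _ => rfl)
    (x₀ := ⟨x, SimpleGraph.ConnectedComponent.connectedComponentMk_mem⟩)
    (y₀ := ⟨y, SimpleGraph.ConnectedComponent.connectedComponentMk_mem⟩) h)

/-- The vanishing of the off-diagonal blocks is needed only for the row and column sums to remain
`1`; all other relations restrict to any diagonal block. -/
theorem IsQutMatrix.block {A : Type*} [CStarAlgebra A]
    {w : Matrix (Σ i, V i) (Σ i, V i) A} (hw : (disjointUnion X).IsQutMatrix w)
    (h0 : ∀ i j, i ≠ j → ∀ x y, w ⟨i, x⟩ ⟨j, y⟩ = 0) (i : I) :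
    (X i).IsQutMatrix (Matrix.of fun x y : V i => w ⟨i, x⟩ ⟨i, y⟩) where
  magic :=
    { star_eq := fun x y => hw.magic.star_eq _ _
      mul_self := fun x y => hw.magic.mul_self _ _
      sum_row := fun x => by
        rw [← hw.magic.sum_row ⟨i, x⟩, Fintype.sum_sigma, Finset.sum_eq_single i]
        · rfl
        · exact fun j _ hj => Finset.sum_eq_zero fun y _ => h0 i j hj.symm x y
        · exact fun h => (h (Finset.mem_univ i)).elim
      sum_col := fun y => by
        rw [← hw.magic.sum_col ⟨i, y⟩, Fintype.sum_sigma, Finset.sum_eq_single i]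
        · rfl
        · exact fun j _ hj => Finset.sum_eq_zero fun x _ => h0 j i hj x y
        · exact fun h => (h (Finset.mem_univ i)).elim }
  adj_left x y x' y' h h' := hw.adj_left _ _ _ _ ((disjointUnion_adj_iff X).2 h)
    fun h'' => h' ((disjointUnion_adj_iff X).1 h'')
  adj_right x y x' y' h h' := hw.adj_right _ _ _ _
    (fun h'' => h ((disjointUnion_adj_iff X).1 h'')) ((disjointUnion_adj_iff X).2 h')
  color x y h := hw.color _ _ h

/-- In each adjacency relation the edge forces two of the four vertices into the same summand.
Either the other two lie there as well and the relation of that summand applies, or one factor is an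
off-diagonal zero. -/
theorem isQutMatrix_blockDiagonal' [DecidableEq I] {A : Type*} [CStarAlgebra A]
    {w : ∀ i, Matrix (V i) (V i) A} (hw : ∀ i, (X i).IsQutMatrix (w i)) :
    (disjointUnion X).IsQutMatrix (Matrix.blockDiagonal' w) where
  magic :=
    { star_eq := by
        rintro ⟨i, x⟩ ⟨j, y⟩
        by_cases hij : i = j
        · subst hij
          simpa using (hw i).magic.star_eq x y
        · rw [Matrix.blockDiagonal'_apply_ne _ _ _ hij, star_zero]
      mul_self := by
        rintro ⟨i, x⟩ ⟨j, y⟩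
        by_cases hij : i = j
        · subst hij
          simpa using (hw i).magic.mul_self x y
        · rw [Matrix.blockDiagonal'_apply_ne _ _ _ hij, mul_zero]
      sum_row := by
        rintro ⟨i, x⟩
        rw [Fintype.sum_sigma, Finset.sum_eq_single i]
        · simpa using (hw i).magic.sum_row x
        · exact fun j _ hj => Finset.sum_eq_zero fun y _ =>
            Matrix.blockDiagonal'_apply_ne _ _ _ hj.symm
        · exact fun h => (h (Finset.mem_univ i)).elim
      sum_col := by
        rintro ⟨i, y⟩
        rw [Fintype.sum_sigma, Finset.sum_eq_single i]
        · simpa using (hw i).magic.sum_col y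
        · exact fun j _ hj => Finset.sum_eq_zero fun x _ =>
            Matrix.blockDiagonal'_apply_ne _ _ _ hj
        · exact fun h => (h (Finset.mem_univ i)).elim }
  adj_left := by
    rintro ⟨i, x⟩ ⟨j, y⟩ ⟨i', x'⟩ ⟨j', y'⟩ h h'
    obtain rfl : i = i' := fst_eq_of_disjointUnion_adj X h
    by_cases hj : i = j
    · by_cases hj' : i = j'
      · subst hj hj'
        simpa using (hw i).adj_left x y x' y' ((disjointUnion_adj_iff X).1 h)
          fun h'' => h' ((disjointUnion_adj_iff X).2 h'')
      · rw [Matrix.blockDiagonal'_apply_ne _ x' y' hj', mul_zero]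
    · rw [Matrix.blockDiagonal'_apply_ne _ x y hj, zero_mul]
  adj_right := by
    rintro ⟨i, x⟩ ⟨j, y⟩ ⟨i', x'⟩ ⟨j', y'⟩ h h'
    obtain rfl : j = j' := fst_eq_of_disjointUnion_adj X h'
    by_cases hj : i = j
    · by_cases hj' : i' = j
      · subst hj hj'
        simpa using (hw i').adj_right x y x' y'
          (fun h'' => h ((disjointUnion_adj_iff X).2 h'')) ((disjointUnion_adj_iff X).1 h')
      · rw [Matrix.blockDiagonal'_apply_ne _ x' y' hj', mul_zero]
    · rw [Matrix.blockDiagonal'_apply_ne _ x y hj, zero_mul]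
  color := by
    rintro ⟨i, x⟩ ⟨j, y⟩ h
    by_cases hij : i = j
    · subst hij
      simpa using (hw i).color x y h
    · exact Matrix.blockDiagonal'_apply_ne _ _ _ hij

theorem IsQutMatrix.map {W C A B : Type*} [Fintype W] [CStarAlgebra A] [CStarAlgebra B]
    {Y : ColoredGraph W C} {w : Matrix W W A} (hw : Y.IsQutMatrix w) (φ : A →⋆ₐ[ℂ] B) :
    Y.IsQutMatrix (w.map φ) where
  magic :=
    { star_eq := fun x y => by rw [Matrix.map_apply, ← map_star, hw.magic.star_eq]
      mul_self := fun x y => by rw [Matrix.map_apply, ← map_mul, hw.magic.mul_self]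
      sum_row := fun x => by simp_rw [Matrix.map_apply, ← map_sum, hw.magic.sum_row, map_one]
      sum_col := fun y => by simp_rw [Matrix.map_apply, ← map_sum, hw.magic.sum_col, map_one] }
  adj_left x y x' y' h h' := by
    rw [Matrix.map_apply, Matrix.map_apply, ← map_mul, hw.adj_left x y x' y' h h', map_zero]
  adj_right x y x' y' h h' := by
    rw [Matrix.map_apply, Matrix.map_apply, ← map_mul, hw.adj_right x y x' y' h h', map_zero]
  color x y h := by rw [Matrix.map_apply, hw.color x y h, map_zero]

end Blocks

end ColoredGraph

/-! ### Morphisms of compact matrix quantum groups -/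

namespace CompactMatrixQuantumGroup

variable {ι : Type u} [Fintype ι] [DecidableEq ι]

/-- *-homomorphisms between C*-algebras are contractive, so the equalizer is a closed *-subalgebra;
it contains the entries of the fundamental representation, which generate. -/
theorem starAlgHom_ext (G : CompactMatrixQuantumGroup ι) {B : Type*} [CStarAlgebra B]
    {φ ψ : G.Carrier →⋆ₐ[ℂ] B} (h : ∀ i j, φ (G.fund i j) = ψ (G.fund i j)) : φ = ψ := by
  have hcont : ∀ χ : G.Carrier →⋆ₐ[ℂ] B, Continuous χ := fun χ =>
    (AddMonoidHomClass.lipschitz_of_bound χ 1 fun a => by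
      rw [one_mul]; exact NonUnitalStarAlgHom.norm_apply_le χ a).continuous
  have h1 : StarAlgebra.adjoin ℂ (Set.range fun ij : ι × ι => G.fund ij.1 ij.2) ≤
      StarAlgHom.equalizer φ ψ := by
    rw [StarAlgebra.adjoin_le_iff]
    rintro _ ⟨⟨i, j⟩, rfl⟩
    exact h i j
  have h2 := StarSubalgebra.topologicalClosure_minimal h1 (isClosed_eq (hcont φ) (hcont ψ))
  rw [G.generates] at h2
  exact StarAlgHom.ext fun a => h2 (StarSubalgebra.mem_top (x := a))

/-- Two compact matrix quantum groups are the same if there are *-homomorphisms in both directions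
that carry the fundamental representations to each other. -/
theorem same_of_starAlgHom {G H : CompactMatrixQuantumGroup ι} (φ : G.Carrier →⋆ₐ[ℂ] H.Carrier)
    (ψ : H.Carrier →⋆ₐ[ℂ] G.Carrier) (hφ : ∀ i j, φ (G.fund i j) = H.fund i j)
    (hψ : ∀ i j, ψ (H.fund i j) = G.fund i j) : Same G H := by
  have h1 : ψ.comp φ = StarAlgHom.id ℂ _ := G.starAlgHom_ext fun i j => by
    rw [StarAlgHom.comp_apply, hφ, hψ]; rfl
  have h2 : φ.comp ψ = StarAlgHom.id ℂ _ := H.starAlgHom_ext fun i j => by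
    rw [StarAlgHom.comp_apply, hψ, hφ]; rfl
  -- Compatibility with the comultiplications is automatic: both composites send `G.fund i j` to the
  -- sum of the `H.fund i k ⊗ H.fund k j`.
  have h3 : H.comul.comp φ = (MinTensor.map φ φ).comp G.comul := G.starAlgHom_ext fun i j => by
    rw [StarAlgHom.comp_apply, StarAlgHom.comp_apply, hφ, H.comul_fund, G.comul_fund, map_sum]
    simp_rw [MinTensor.map_tmul, hφ]
  refine ⟨StarAlgEquiv.ofStarAlgHom φ ψ h1 h2, hφ, fun a => ?_⟩
  exact DFunLike.congr_fun h3 a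

end CompactMatrixQuantumGroup

/-! ### The isomorphism with the free product -/

theorem mainTheorem4 {n : ℕ} {C : Type*} {V : Fin n → Type u} [∀ i, Fintype (V i)]
    [∀ i, DecidableEq (V i)] (X : ∀ i, ColoredGraph (V i) C)
    (hX : ∀ i j, i ≠ j → ∀ (K : (X i).graph.ConnectedComponent)
      (L : (X j).graph.ConnectedComponent),
      ¬ ((X i).component K).QuantumIsomorphic ((X j).component L)) :
    CompactMatrixQuantumGroup.Same (ColoredGraph.disjointUnion X).qut
      (CompactMatrixQuantumGroup.freeProduct fun i => (X i).qut) := by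
  have hu := (ColoredGraph.disjointUnion X).isQutMatrix_qutFund
  -- The hypothesis on components is used only here. It is what makes the map out of the free
  -- product exist and carry the block-diagonal matrix to the fundamental representation of the
  -- union.
  have h0 : ∀ i j, i ≠ j → ∀ x y, (ColoredGraph.disjointUnion X).qutFund ⟨i, x⟩ ⟨j, y⟩ = 0 :=
    fun i j hij x y => hu.entry_eq_zero hX hij x y
  have hv : (ColoredGraph.disjointUnion X).IsQutMatrix
      (CompactMatrixQuantumGroup.freeProductFund fun i => (X i).qut) :=
    ColoredGraph.isQutMatrix_blockDiagonal' fun i => (X i).isQutMatrix_qutFund.map _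
  refine CompactMatrixQuantumGroup.same_of_starAlgHom
    (G := (ColoredGraph.disjointUnion X).qut)
    (H := CompactMatrixQuantumGroup.freeProduct fun i => (X i).qut)
    ((ColoredGraph.disjointUnion X).qutLift _ hv)
    (FreeProductCStar.lift (A := fun i => (X i).qut.Carrier)
      fun i => (X i).qutLift _ (hu.block h0 i))
    (fun i j => (ColoredGraph.disjointUnion X).qutLift_fund _ hv i j) ?_
  rintro ⟨i, x⟩ ⟨j, y⟩
  change FreeProductCStar.lift _
    (CompactMatrixQuantumGroup.freeProductFund (fun i => (X i).qut) ⟨i, x⟩ ⟨j, y⟩) =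
      (ColoredGraph.disjointUnion X).qutFund ⟨i, x⟩ ⟨j, y⟩
  -- On diagonal blocks the universal properties give the value; off the diagonal both sides vanish,
  -- the right one by `h0`.
  by_cases hij : i = j
  · subst hij
    rw [CompactMatrixQuantumGroup.freeProductFund, Matrix.blockDiagonal'_apply_eq]
    exact (FreeProductCStar.lift_incl _ i _).trans ((X i).qutLift_fund _ (hu.block h0 i) x y)
  · rw [CompactMatrixQuantumGroup.freeProductFund, Matrix.blockDiagonal'_apply_ne _ _ _ hij,
      map_zero, h0 i j hij]
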